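/- Let $\mathbb T^2=\mathbb R^2/\mathbb Z^2$, let $H$ and $V$ be the closures in $L^2(\mathbb T^2)^2$ and $H^1(\mathbb T^2)^2$ of the divergence-free, zero-average vector-valued real trigonometric polynomials, and let $P_\sigma$ be the orthogonal projector of $L^2(\mathbb T^2)^2$ onto $H$. Let $\nu,\mu,\kappa,g>0$ and $\alpha\in\mathbb R$, let $\zeta:\mathbb R\to\mathbb R$ be a bounded, globally Lipschitz (calming) function, and let $T>0$. Consider on $\mathbb T^2\times[0,T]$ the calmed system $$\partial_t u-\nu\Delta u+(u\cdot\nabla)u+\nabla p=(b\cdot\nabla)b+g\theta\vec e_2,\qquad \partial_t b-\mu\Delta b+(u\cdot\nabla)b=(b\cdot\nabla)u,$$ $$\partial_t\theta-\kappa\Delta\theta+(u\cdot\nabla)\theta=\alpha\mu\,\zeta(|\nabla\times b|)\,|\nabla\times b|,\qquad \nabla\cdot u=0=\nabla\cdot b .$$ A strong solution on $[0,T]$ with initial data $(u_0,b_0,\theta_0)$ is a triple $(u,b,\theta)$ with $$u,b\in C([0,T];H^2\cap V)\cap L^2(0,T;H^3\cap V),\qquad \partial_tu,\partial_tb\in L^2(0,T;H),$$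 $$\theta\in C([0,T];L^2)\cap L^\infty(0,T;H^2)\cap L^2(0,T;H^3),\qquad \partial_t\theta\in L^2(0,T;H^{-1}),$$ which satisfies $u(0)=u_0$, $b(0)=b_0$, $\theta(0)=\theta_0$, and satisfies the first two equations, after projection by $P_\sigma$, in $L^2(0,T;H)$ and the third one in $L^2(0,T;H^{-1})$. Let $(u_0,b_0,\theta_0)\in(H^2\cap V)\times(H^2\cap V)\times L^2$. Then: (i) (Uniqueness) any two strong solutions on $[0,T]$ with initial data $(u_0,b_0,\theta_0)$ coincide at every $t\in[0,T]$; (ii) (Continuous dependence in $L^2$) there is a constant $K>0$, depending only on $\nu,\mu,\kappa,g,\alpha,\zeta,T$ and $(u_0,b_0,\theta_0)$, such that, if $(u,b,\theta)$ is a strong solution with initial data $(u_0,b_0,\theta_0)$ and $(v,c,\eta)$ is a strong solution with any initial data $(v_0,c_0,\eta_0)\in(H^2\cap V)\times(H^2\cap V)\times L^2$, then for all $t\in[0,T]$ $$\|u(t)-v(t)\|_{L^2}^2+\|b(t)-c(t)\|_{L^2}^2+\|\theta(t)-\eta(t)\|_{L^2}^2\le K\left(\|u_0-v_0\|_{L^2}^2+\|b_0-c_0\|_{L^2}^2+\|\theta_0-\eta_0\|_{L^2}^2\right).$$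 -/

import Mathlib

open MeasureTheory Set
open scoped ContDiff NNReal ENNReal

noncomputable section

namespace CalmedMHD

/-! ### The torus, its Lebesgue measure and the space `L²` -/

/-- The two-dimensional torus `ℝ² / ℤ²`. -/
abbrev T2 : Type := UnitAddTorus (Fin 2)

/-- Lebesgue measure on the torus: the product of the Haar measures of total mass one. -/
abbrev torusMeasure : Measure T2 :=
  Measure.pi fun _ : Fin 2 => (AddCircle.haarAddCircle : Measure UnitAddCircle)

/-- The plane with its Euclidean norm. -/
abbrev Vec : Type := EuclideanSpace ℝ (Fin 2)

/-- `L²(𝕋²; E)`. -/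
abbrev L2 (E : Type) [NormedAddCommGroup E] : Type := Lp E 2 torusMeasure

/-! ### Test functions and weak derivatives on the torus -/

/-- The projection `ℝ² → ℝ² / ℤ²`. -/
def proj (y : Fin 2 → ℝ) : T2 := fun i => (y i : UnitAddCircle)

/-- Smoothness of a function on the torus: its periodic lift to `ℝ²` is smooth. -/
def IsSmooth (φ : T2 → ℝ) : Prop := ContDiff ℝ ∞ fun y => φ (proj y)

/-- The classical partial derivative `∂φ/∂x_j` of a function on the torus. -/
def pderiv (j : Fin 2) (φ : T2 → ℝ) (x : T2) : ℝ :=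
  deriv (fun h : ℝ => φ (x + Pi.single j (h : UnitAddCircle))) 0

/-- The classical derivative `∂^α φ = ∂₁^{α₁} ∂₂^{α₂} φ`. -/
def mderiv (α : Fin 2 → ℕ) (φ : T2 → ℝ) : T2 → ℝ :=
  (pderiv 0)^[α 0] ((pderiv 1)^[α 1] φ)

/-- `g` is the weak derivative `∂^α f` of `f`, for `f, g ∈ L²(𝕋²; E)`. -/
def IsWeakDeriv {E : Type} [NormedAddCommGroup E] [NormedSpace ℝ E]
    (α : Fin 2 → ℕ) (f g : L2 E) : Prop :=
  ∀ φ : T2 → ℝ, IsSmooth φ →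
    ∫ x, mderiv α φ x • f x ∂torusMeasure
      = (-1 : ℝ) ^ (∑ i, α i) • ∫ x, φ x • g x ∂torusMeasure

open Classical in
/-- The weak derivative `∂^α f` in `L²(𝕋²; E)`; it is used only where it exists
(otherwise the value is `0`). -/
def wderiv {E : Type} [NormedAddCommGroup E] [NormedSpace ℝ E]
    (α : Fin 2 → ℕ) (f : L2 E) : L2 E :=
  if h : ∃ g, IsWeakDeriv α f g then h.choose else 0

/-- The first-order weak derivative `∂_j f`. -/
def wd {E : Type} [NormedAddCommGroup E] [NormedSpace ℝ E] (j : Fin 2) (f : L2 E) : L2 E :=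
  wderiv (Pi.single j 1) f

/-- The Laplacian `Δf = ∂₁² f + ∂₂² f`, with weak derivatives. -/
def lap {E : Type} [NormedAddCommGroup E] [NormedSpace ℝ E] (f : L2 E) : L2 E :=
  ∑ j, wderiv (Pi.single j 2) f

/-! Facts on test functions that are needed to see that `H^k` is a vector space. -/

theorem proj_add_single (y : Fin 2 → ℝ) (j : Fin 2) (h : ℝ) :
    proj y + Pi.single j (h : UnitAddCircle) = proj (y + h • Pi.single j 1) := by
  funext i
  by_cases hij : i = j
  · subst hij; simp [proj]
  · simp [proj, hij]

theorem IsSmooth.pderiv {φ : T2 → ℝ} (hφ : IsSmooth φ) (j : Fin 2) :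
    IsSmooth (pderiv j φ) := by
  have key : (fun y => CalmedMHD.pderiv j φ (proj y))
      = fun y => fderiv ℝ (fun y => φ (proj y)) y (Pi.single j 1) := by
    funext y
    unfold CalmedMHD.pderiv
    simp_rw [proj_add_single]
    have hd : HasFDerivAt (fun y => φ (proj y)) (fderiv ℝ (fun y => φ (proj y)) y)
        (y + (0 : ℝ) • (Pi.single j 1 : Fin 2 → ℝ)) := by
      simpa using (hφ.differentiable (by simp) y).hasFDerivAt
    have hl : HasDerivAt (fun h : ℝ => y + h • (Pi.single j 1 : Fin 2 → ℝ))
        (Pi.single j 1) 0 := by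
      simpa using ((hasDerivAt_id (0 : ℝ)).smul_const (Pi.single j 1 : Fin 2 → ℝ)).const_add y
    exact (hd.comp_hasDerivAt (0 : ℝ) hl).deriv
  unfold IsSmooth
  rw [key]
  exact (hφ.fderiv_right (m := ∞) (by simp)).clm_apply contDiff_const

theorem IsSmooth.mderiv {φ : T2 → ℝ} (hφ : IsSmooth φ) (α : Fin 2 → ℕ) :
    IsSmooth (mderiv α φ) := by
  have it : ∀ (j : Fin 2) (n : ℕ) (ψ : T2 → ℝ), IsSmooth ψ →
      IsSmooth ((CalmedMHD.pderiv j)^[n] ψ) := by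
    intro j n
    induction n with
    | zero => intro ψ h; simpa using h
    | succ n ih => intro ψ h; exact ih _ (h.pderiv j)
  exact it 0 _ _ (it 1 _ _ hφ)

theorem IsSmooth.continuous {φ : T2 → ℝ} (hφ : IsSmooth φ) : Continuous φ := by
  have hq : IsOpenQuotientMap proj :=
    IsOpenQuotientMap.piMap (f := fun (_ : Fin 2) (t : ℝ) => (t : UnitAddCircle))
      fun _ => QuotientAddGroup.isOpenQuotientMap_mk
  exact hq.isQuotientMap.continuous_iff.2 (ContDiff.continuous (𝕜 := ℝ) hφ)

theorem IsSmooth.integrable_smul {E : Type} [NormedAddCommGroup E] [NormedSpace ℝ E]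
    {φ : T2 → ℝ} (hφ : IsSmooth φ) (f : L2 E) :
    Integrable (fun x => φ x • f x) torusMeasure := by
  obtain ⟨C, hC⟩ := isCompact_univ.exists_bound_of_continuousOn hφ.continuous.continuousOn
  have hf : Integrable f torusMeasure := (Lp.memLp f).integrable (by norm_num)
  exact hf.bdd_smul C hφ.continuous.aestronglyMeasurable
    (Filter.Eventually.of_forall fun x => hC x (mem_univ x))

/-! ### The Sobolev spaces `H^k = W^{k,2}` -/

/-- The multi-indices `α` with `|α| ≤ k`. -/
def multiIdx (k : ℕ) : Finset (Fin 2 → ℕ) :=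
  (Fintype.piFinset fun _ => Finset.range (k + 1)).filter fun α => ∑ i, α i ≤ k

theorem zero_mem_multiIdx (k : ℕ) : (0 : Fin 2 → ℕ) ∈ multiIdx k := by
  simp [multiIdx]

/-- The Sobolev space `H^k(𝕋²; E)`, as the space of the families `(∂^α f)_{|α| ≤ k}` in `L²`,
with the norm `(∑_{|α| ≤ k} ‖∂^α f‖²)^{1/2}`. -/
def Sob (k : ℕ) (E : Type) [NormedAddCommGroup E] [NormedSpace ℝ E] :
    Submodule ℝ (PiLp 2 fun _ : multiIdx k => L2 E) where
  carrier := {F | ∀ α : multiIdx k, IsWeakDeriv α (F ⟨0, zero_mem_multiIdx k⟩) (F α)}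
  zero_mem' := by
    intro α φ _
    have h0 : ∀ ψ : T2 → ℝ, ∫ x, ψ x • (0 : L2 E) x ∂torusMeasure = 0 := by
      intro ψ
      refine integral_eq_zero_of_ae ?_
      filter_upwards [Lp.coeFn_zero E 2 torusMeasure] with x hx
      rw [hx, Pi.zero_apply, smul_zero]
    simp only [PiLp.zero_apply, h0, smul_zero]
  add_mem' := by
    intro F G hF hG α φ hφ
    have hadd : ∀ (ψ : T2 → ℝ), IsSmooth ψ → ∀ f g : L2 E,
        ∫ x, ψ x • (f + g) x ∂torusMeasure
          = ∫ x, ψ x • f x ∂torusMeasure + ∫ x, ψ x • g x ∂torusMeasure := by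
      intro ψ hψ f g
      rw [← integral_add (hψ.integrable_smul f) (hψ.integrable_smul g)]
      refine integral_congr_ae ?_
      filter_upwards [Lp.coeFn_add f g] with x hx
      rw [hx, Pi.add_apply, smul_add]
    simp only [PiLp.add_apply]
    rw [hadd _ (hφ.mderiv α), hadd _ hφ, hF α φ hφ, hG α φ hφ, smul_add]
  smul_mem' := by
    intro c F hF α φ hφ
    have hsm : ∀ (ψ : T2 → ℝ) (f : L2 E),
        ∫ x, ψ x • (c • f) x ∂torusMeasure = c • ∫ x, ψ x • f x ∂torusMeasure := by
      intro ψ f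
      rw [← integral_smul]
      refine integral_congr_ae ?_
      filter_upwards [Lp.coeFn_smul c f] with x hx
      rw [hx, Pi.smul_apply, smul_comm]
    simp only [PiLp.smul_apply]
    rw [hsm, hsm, hF α φ hφ, smul_comm]

/-- The inclusion `H^k ⊂ L²`. -/
def toL2 (k : ℕ) (E : Type) [NormedAddCommGroup E] [NormedSpace ℝ E] : Sob k E →L[ℝ] L2 E :=
  (PiLp.proj 2 (𝕜 := ℝ) (fun _ : multiIdx k => L2 E) ⟨0, zero_mem_multiIdx k⟩).comp
    (Sob k E).subtypeL

/-- `H^k` as a subspace of `L²`. -/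
def sobSet (k : ℕ) (E : Type) [NormedAddCommGroup E] [NormedSpace ℝ E] : Submodule ℝ (L2 E) :=
  LinearMap.range (toL2 k E).toLinearMap

/-- `H⁻¹`, the dual of `H¹`. -/
abbrev HNegOne : Type := Sob 1 ℝ →L[ℝ] ℝ

/-- The inclusion `L² ⊂ H⁻¹`, `f ↦ (ψ ↦ ∫ f ψ)`. -/
def toHNegOne (f : L2 ℝ) : HNegOne := (innerSL ℝ f).comp (toL2 1 ℝ)

/-! ### The spaces `H` and `V` and the Leray projector -/

/-- The vector-valued real trigonometric polynomial with components
`Re ∑_{k ∈ F} c_{k,j} e^{2πi k·x}`. -/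
def trigPoly (F : Finset (Fin 2 → ℤ)) (c : (Fin 2 → ℤ) → Fin 2 → ℂ) (x : T2) : Vec :=
  WithLp.toLp 2 fun j => (∑ k ∈ F, c k j * UnitAddTorus.mFourier k x).re

/-- The (classes in `L²` of the) vector-valued trigonometric polynomials that are
divergence free and have zero average. -/
def trigDivFree : Set (L2 Vec) :=
  {v | ∃ F c, v =ᵐ[torusMeasure] trigPoly F c ∧
    (∀ x, ∑ j, pderiv j (fun y => trigPoly F c y j) x = 0) ∧
    ∫ x, trigPoly F c x ∂torusMeasure = 0}

/-- `H`: the closure in `L²` of the divergence-free zero-average trigonometric polynomials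
(which form a vector space, so that taking their span adds nothing). -/
def spaceH : Submodule ℝ (L2 Vec) := (Submodule.span ℝ trigDivFree).topologicalClosure

instance : CompleteSpace spaceH := by
  unfold spaceH
  infer_instance

/-- `V`: the closure of the same set in `H¹`. -/
def spaceV1 : Submodule ℝ (Sob 1 Vec) :=
  (Submodule.span ℝ (toL2 1 Vec ⁻¹' trigDivFree)).topologicalClosure

/-- `V` as a subspace of `L²`. -/
def spaceV : Submodule ℝ (L2 Vec) := spaceV1.map (toL2 1 Vec).toLinearMap

/-- The Leray-Helmholtz projector `P_σ`: the orthogonal projector of `L²` onto `H`. -/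
def leray : L2 Vec →L[ℝ] L2 Vec := spaceH.starProjection

/-! ### Spaces of functions of time -/

/-- `f ∈ C([0,T]; H^k)`. -/
def InC {E : Type} [NormedAddCommGroup E] [NormedSpace ℝ E]
    (T : ℝ) (k : ℕ) (f : ℝ → L2 E) : Prop :=
  ∃ U : ℝ → Sob k E, ContinuousOn U (Icc 0 T) ∧ ∀ t ∈ Icc 0 T, toL2 k E (U t) = f t

/-- `f ∈ L^p(0,T; H^k)`. -/
def InLp {E : Type} [NormedAddCommGroup E] [NormedSpace ℝ E]
    (T : ℝ) (p : ℝ≥0∞) (k : ℕ) (f : ℝ → L2 E) : Prop :=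
  ∃ U : ℝ → Sob k E, MemLp U p (volume.restrict (Ioo 0 T)) ∧
    ∀ᵐ t ∂volume.restrict (Ioo 0 T), toL2 k E (U t) = f t

/-- `v'` is the weak time derivative of `v` on `(0,T)`, in the Banach space `X`. -/
def IsTimeDeriv {X : Type} [NormedAddCommGroup X] [NormedSpace ℝ X]
    (T : ℝ) (v v' : ℝ → X) : Prop :=
  ∀ φ : ℝ → ℝ, ContDiff ℝ ∞ φ → HasCompactSupport φ → tsupport φ ⊆ Ioo 0 T →
    ∫ t in Ioo 0 T, deriv φ t • v t = -∫ t in Ioo 0 T, φ t • v' t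

/-! ### The calmed system -/

/-- `(u · ∇) f = u₁ ∂₁ f + u₂ ∂₂ f`. -/
def adv {E : Type} [NormedAddCommGroup E] [NormedSpace ℝ E]
    (u : L2 Vec) (f : L2 E) (x : T2) : E :=
  ∑ j, u x j • wd j f x

/-- `|∇ × b| = |∂₁ b₂ - ∂₂ b₁|`. -/
def absCurl (b : L2 Vec) (x : T2) : ℝ := |wd 0 b x 1 - wd 1 b x 0|

/-- Semi-strong solutions on `[0,T]`, with initial data `(u₀, b₀, θ₀)`, of the calmed system
`∂ₜu - νΔu + (u·∇)u + ∇p = (b·∇)b + gθe₂`, `∂ₜb - μΔb + (u·∇)b = (b·∇)u`,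
`∂ₜθ - κΔθ + (u·∇)θ = αμ ζ(|∇×b|)|∇×b|`, `∇·u = ∇·b = 0`.

The first two equations hold in `L²(0,T; H)`, after projection by `P_σ`, which removes the
pressure (and changes nothing in the second one); the third one holds in `L²(0,T; H⁻¹)`. -/
structure IsSemiStrong (ν μ κ g α : ℝ) (ζ : ℝ → ℝ) (T : ℝ) (u₀ b₀ : L2 Vec) (θ₀ : L2 ℝ)
    (u b : ℝ → L2 Vec) (θ : ℝ → L2 ℝ) : Prop where
  u_cont : InC T 1 u
  b_cont : InC T 1 b
  u_mem : ∀ t ∈ Icc 0 T, u t ∈ spaceV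
  b_mem : ∀ t ∈ Icc 0 T, b t ∈ spaceV
  θ_cont : ContinuousOn θ (Icc 0 T)
  u_int : InLp T 2 2 u
  b_int : InLp T 2 2 b
  θ_int : InLp T 2 1 θ
  u_init : u 0 = u₀
  b_init : b 0 = b₀
  θ_init : θ 0 = θ₀
  u_eq : ∃ u' : ℝ → L2 Vec, MemLp u' 2 (volume.restrict (Ioo 0 T)) ∧ IsTimeDeriv T u u' ∧
    ∀ᵐ t ∂volume.restrict (Ioo 0 T), u' t ∈ spaceH ∧
      ∃ R : L2 Vec, (R =ᵐ[torusMeasure] fun x =>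
          ν • lap (u t) x - adv (u t) (u t) x + adv (b t) (b t) x
            + (g * θ t x) • EuclideanSpace.single (1 : Fin 2) (1 : ℝ)) ∧
        u' t = leray R
  b_eq : ∃ b' : ℝ → L2 Vec, MemLp b' 2 (volume.restrict (Ioo 0 T)) ∧ IsTimeDeriv T b b' ∧
    ∀ᵐ t ∂volume.restrict (Ioo 0 T), b' t ∈ spaceH ∧
      ∃ R : L2 Vec, (R =ᵐ[torusMeasure] fun x =>
          μ • lap (b t) x - adv (u t) (b t) x + adv (b t) (u t) x) ∧
        b' t = leray R
  θ_eq : ∃ θ' : ℝ → HNegOne, MemLp θ' 2 (volume.restrict (Ioo 0 T)) ∧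
    IsTimeDeriv T (fun t => toHNegOne (θ t)) θ' ∧
    ∀ᵐ t ∂volume.restrict (Ioo 0 T), ∀ ψ : Sob 1 ℝ,
      θ' t ψ = -κ * ∫ x, ∑ j, wd j (θ t) x * wd j (toL2 1 ℝ ψ) x ∂torusMeasure
        - ∫ x, adv (u t) (θ t) x * toL2 1 ℝ ψ x ∂torusMeasure
        + α * μ * ∫ x, ζ (absCurl (b t) x) * absCurl (b t) x * toL2 1 ℝ ψ x ∂torusMeasure

/-- Strong solutions: semi-strong solutions with, moreover,
`u, b ∈ C([0,T]; H² ∩ V) ∩ L²(0,T; H³ ∩ V)` and `θ ∈ L^∞(0,T; H²) ∩ L²(0,T; H³)`. -/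
structure IsStrong (ν μ κ g α : ℝ) (ζ : ℝ → ℝ) (T : ℝ) (u₀ b₀ : L2 Vec) (θ₀ : L2 ℝ)
    (u b : ℝ → L2 Vec) (θ : ℝ → L2 ℝ) : Prop
    extends IsSemiStrong ν μ κ g α ζ T u₀ b₀ θ₀ u b θ where
  u_cont2 : InC T 2 u
  b_cont2 : InC T 2 b
  u_int3 : InLp T 2 3 u
  b_int3 : InLp T 2 3 b
  θ_bdd2 : InLp T ⊤ 2 θ
  θ_int3 : InLp T 2 3 θ

end CalmedMHD

end

/-! Let `w = u - v`, `d = b - c`, `φ = θ - η`. Subtract the equations and test them with `w`, `d`,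
`φ`. In every transport term the difference is split so that the undifferentiated factor carries the
difference and the gradient falls on the first solution, for instance `(u·∇)u - (v·∇)v = (w·∇)u +
(v·∇)w`. The remainders `(v·∇)w·w`, `(v·∇)d·d`, `(v·∇)φ φ` integrate to zero because `div v = 0`,
and the two magnetic remainders `(c·∇)d·w` and `(c·∇)w·d` cancel each other because `div c = 0`.
What is left is quadratic in `(w, d, φ)` with coefficients `∇u`, `∇b`, `∇θ`, and these are bounded
for almost every time by the embedding of `H³` in `W^{1,∞}` (`Sob.ae_abs_wd_le`).

The calmed source is the only term that sees `∇d`. The map `r ↦ ζ(r) r` has slope at most `L|∇×b| +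
M` between the two curls (`calm_sub_le`), so Young's inequality absorbs `|∇d|` in the magnetic
diffusion. This yields `energy_inequality`, with a growth rate quadratic in the `H³` norms of the
first solution. These norms are square integrable in time, so the rate is integrable and Gronwall's
inequality gives `stability`.

Differentiating the squared norms takes two forms. For `u` and `b` the time derivative is in
`L²(0,T; L²)`, the curve is absolutely continuous and the chain rule applies. For `θ` it is only in
`L²(0,T; H⁻¹)`, and the Lions–Magenes identity `norm_sq_eq_add_integral_dual` is proved by
regularizing the norm with the resolvents `(ε + ι*ι)⁻¹` of the inclusion `ι` of `H¹` in `L²`.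

Spatial integration by parts and uniqueness of weak derivatives are read off from Fourier
coefficients. Uniqueness is stability with equal data; it also makes the constant in (ii) depend on
the data alone. -/

noncomputable section

namespace CalmedMHD

/-! ### Fourier coefficients and Parseval's identity -/

section

open UnitAddTorus
open scoped ComplexConjugate

/-- Fourier coefficients of a real function on the torus. -/
def fc (f : T2 → ℝ) (n : Fin 2 → ℤ) : ℂ := ∫ x, mFourier (-n) x * (f x : ℂ) ∂torusMeasure

/-- A square-integrable real function as an element of the complex `L²`. -/
def toC {f : T2 → ℝ} (hf : MemLp f 2 torusMeasure) : Lp ℂ 2 torusMeasure :=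
  MemLp.toLp (fun x => (f x : ℂ)) hf.ofReal

theorem toC_coe {f : T2 → ℝ} (hf : MemLp f 2 torusMeasure) :
    toC hf =ᵐ[torusMeasure] fun x => (f x : ℂ) := MemLp.coeFn_toLp _

theorem mFourierCoeff_toC {f : T2 → ℝ} (hf : MemLp f 2 torusMeasure) (n : Fin 2 → ℤ) :
    mFourierCoeff (toC hf) n = fc f n := by
  refine integral_congr_ae ?_
  filter_upwards [toC_coe hf] with x hx
  rw [hx, smul_eq_mul]

/-- Polarized Parseval identity; integration by parts (`WDer.ibp`) is a termwise identity between
two such series. -/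
theorem hasSum_fc_mul {f g : T2 → ℝ} (hf : MemLp f 2 torusMeasure) (hg : MemLp g 2 torusMeasure) :
    HasSum (fun n => conj (fc f n) * fc g n) ((∫ x, f x * g x ∂torusMeasure : ℝ) : ℂ) := by
  have h := hasSum_prod_mFourierCoeff (d := Fin 2) (toC hf) (toC hg)
  simp only [mFourierCoeff_toC] at h
  convert h using 1
  rw [← integral_complex_ofReal]
  refine integral_congr_ae ?_
  filter_upwards [toC_coe hf, toC_coe hg] with x hx hy
  rw [hx, hy]; simp

theorem hasSum_fc_sq {f : T2 → ℝ} (hf : MemLp f 2 torusMeasure) :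
    HasSum (fun n => ‖fc f n‖ ^ 2) (∫ x, f x ^ 2 ∂torusMeasure) := by
  have h := hasSum_fc_mul hf hf
  have h2 := Complex.hasSum_re h
  convert h2 using 1
  · funext n
    rw [← Complex.normSq_eq_conj_mul_self, Complex.ofReal_re, Complex.normSq_eq_norm_sq]
  · simp [sq]

theorem hasSum_fc_Lp {f : T2 → ℝ} (hf : MemLp f 2 torusMeasure) :
    HasSum (fun n => fc f n • (ContinuousMap.toLp (E := ℂ) 2 torusMeasure ℂ (mFourier n)))
      (toC hf) := by
  have h := hasSum_mFourier_series_L2 (d := Fin 2) (toC hf)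
  simp only [mFourierCoeff_toC] at h
  exact h

theorem ae_eq_of_fc_eq {f g : T2 → ℝ} (hf : MemLp f 2 torusMeasure) (hg : MemLp g 2 torusMeasure)
    (h : ∀ n, fc f n = fc g n) : f =ᵐ[torusMeasure] g := by
  have h1 := hasSum_fc_Lp hf
  simp only [h] at h1
  have h2 := h1.unique (hasSum_fc_Lp hg)
  filter_upwards [toC_coe hf, toC_coe hg] with x hx hy
  rw [h2, hy] at hx
  exact_mod_cast hx.symm

/-! ### Trigonometric test functions -/

theorem mFourier_add_single (n : Fin 2 → ℤ) (x : T2) (j : Fin 2) (h : UnitAddCircle) :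
    mFourier n (x + Pi.single j h) = mFourier n x * fourier (n j) h := by
  simp only [mFourier, ContinuousMap.coe_mk, Fin.prod_univ_two, Pi.add_apply]
  fin_cases j <;> simp [fourier_apply, smul_add, AddCircle.toCircle_add] <;> ring

/-- The real trigonometric monomial `Re (c e^{2πi n·x})`. -/
def trigMon (n : Fin 2 → ℤ) (c : ℂ) (x : T2) : ℝ := (c * mFourier n x).re

theorem pderiv_trigMon (n : Fin 2 → ℤ) (c : ℂ) (j : Fin 2) :
    pderiv j (trigMon n c) = trigMon n (2 * Real.pi * Complex.I * n j * c) := by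
  funext x
  have h := (hasDerivAt_fourier 1 (n j) 0)
  have h2 : HasDerivAt (fun t : ℝ => (c * mFourier n x) * fourier (n j) (t : AddCircle (1:ℝ)))
      ((c * mFourier n x) * (2 * Real.pi * Complex.I * n j)) 0 := by
    refine (h.const_mul (c * mFourier n x)).congr_deriv ?_
    simp
  have h3 := Complex.reCLM.hasFDerivAt.comp_hasDerivAt (0 : ℝ) h2
  unfold pderiv trigMon
  simp_rw [mFourier_add_single, ← mul_assoc]
  refine h3.deriv.trans ?_
  simp only [Complex.reCLM_apply]
  congr 1; ring

theorem isSmooth_trigMon (n : Fin 2 → ℤ) (c : ℂ) : IsSmooth (trigMon n c) := by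
  have : (fun y : Fin 2 → ℝ => trigMon n c (proj y)) = fun y : Fin 2 → ℝ =>
      Complex.reCLM (c * ∏ i, Complex.exp (2 * Real.pi * Complex.I * n i *
        (Complex.ofRealCLM (y i)))) := by
    funext y
    simp [trigMon, proj, mFourier]
  unfold IsSmooth
  rw [this]
  fun_prop

theorem mderiv_trigMon (n : Fin 2 → ℤ) (c : ℂ) (α : Fin 2 → ℕ) :
    mderiv α (trigMon n c) =
      trigMon n ((2 * Real.pi * Complex.I * n 0) ^ α 0 * ((2 * Real.pi * Complex.I * n 1) ^ α 1 * c)) := by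
  have it : ∀ (j : Fin 2) (k : ℕ) (c : ℂ), (pderiv j)^[k] (trigMon n c) =
      trigMon n ((2 * Real.pi * Complex.I * n j) ^ k * c) := by
    intro j k
    induction k with
    | zero => intro c; simp
    | succ k ih =>
      intro c
      rw [Function.iterate_succ_apply, pderiv_trigMon, ih]
      congr 1; ring
  rw [mderiv, it, it]

theorem integral_trigMon_mul {f : T2 → ℝ} (hf : MemLp f 2 torusMeasure) (n : Fin 2 → ℤ) (c : ℂ) :
    ∫ x, trigMon (-n) c x * f x ∂torusMeasure = (c * fc f n).re := by
  have hi : Integrable (fun x => mFourier (-n) x * (f x : ℂ)) torusMeasure := by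
    have hf1 : Integrable (fun x => (f x : ℂ)) torusMeasure :=
      (hf.ofReal (K := ℂ)).integrable (by norm_num)
    refine hf1.bdd_mul (c := 1) (mFourier (-n)).continuous.aestronglyMeasurable ?_
    exact Filter.Eventually.of_forall fun x =>
      ((mFourier (-n)).norm_coe_le_norm x).trans mFourier_norm.le
  rw [fc, ← integral_const_mul]
  have := (Complex.reCLM.integral_comp_comm (hi.const_mul c)).symm
  simp only [Complex.reCLM_apply] at this
  rw [this]
  refine integral_congr_ae (Filter.Eventually.of_forall fun x => ?_)
  simp only [trigMon]
  rw [← mul_assoc, Complex.re_mul_ofReal]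

/-! ### Weak derivatives of functions -/

/-- `g` is the weak derivative `∂^α f`, for square-integrable functions `f`, `g`. -/
structure WDer (α : Fin 2 → ℕ) (f g : T2 → ℝ) : Prop where
  left : MemLp f 2 torusMeasure
  right : MemLp g 2 torusMeasure
  eq : ∀ φ : T2 → ℝ, IsSmooth φ →
    ∫ x, mderiv α φ x * f x ∂torusMeasure = (-1 : ℝ) ^ (∑ i, α i) * ∫ x, φ x * g x ∂torusMeasure

/-- Trigonometric monomials are admissible test functions. Differentiating one of frequency `-n`
produces the multiplier with the sign `(-1)^|α|`, which cancels the sign in the definition. -/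
theorem WDer.fc_eq {α : Fin 2 → ℕ} {f g : T2 → ℝ} (h : WDer α f g) (n : Fin 2 → ℤ) :
    fc g n = (2 * Real.pi * Complex.I * n 0) ^ α 0 * (2 * Real.pi * Complex.I * n 1) ^ α 1
      * fc f n := by
  set r := (2 * Real.pi * Complex.I * n 0) ^ α 0 * (2 * Real.pi * Complex.I * n 1) ^ α 1 with hr
  -- Test functions are real, so each gives only a real part; `c = 1` and `c = i` together recover
  -- the complex coefficient.
  have key : ∀ c : ℂ, (c * (r * fc f n)).re = (c * fc g n).re := by
    intro c
    have h1 := h.eq _ (isSmooth_trigMon (-n) c)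
    rw [mderiv_trigMon, integral_trigMon_mul h.left, integral_trigMon_mul h.right] at h1
    have h2 : (2 * Real.pi * Complex.I * (-n) 0) ^ α 0 *
        ((2 * Real.pi * Complex.I * (-n) 1) ^ α 1 * c) = ((-1 : ℝ) ^ (∑ i, α i) : ℝ) * (c * r) := by
      simp only [hr, Fin.sum_univ_two, Pi.neg_apply, Int.cast_neg, mul_neg]
      rw [neg_pow, neg_pow (2 * Real.pi * Complex.I * (n 1 : ℂ))]
      push_cast
      ring
    have h3 : (((-n) 0 : ℤ) : ℂ) = -(n 0 : ℂ) := by simp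
    rw [h2, mul_assoc, Complex.re_ofReal_mul] at h1
    have h4 : ((-1 : ℝ) ^ (∑ i, α i)) ≠ 0 := pow_ne_zero _ (by norm_num)
    rw [← mul_assoc]
    exact mul_left_cancel₀ h4 h1
  refine (Complex.ext ?_ ?_).symm
  · simpa using key 1
  · have h5 := key Complex.I
    rw [Complex.I_mul_re, Complex.I_mul_re] at h5
    exact neg_injective h5

/-- `wderiv` is obtained by choice; this is what identifies its value with any explicit weak
derivative. -/
theorem WDer.unique {α : Fin 2 → ℕ} {f g g' : T2 → ℝ} (h : WDer α f g) (h' : WDer α f g') :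
    g =ᵐ[torusMeasure] g' :=
  ae_eq_of_fc_eq h.right h'.right fun n => by rw [h.fc_eq, h'.fc_eq]

theorem WDer.fc_single {j : Fin 2} {f g : T2 → ℝ} (h : WDer (Pi.single j 1) f g)
    (n : Fin 2 → ℤ) : fc g n = 2 * Real.pi * Complex.I * n j * fc f n := by
  rw [h.fc_eq]
  fin_cases j <;> simp

/-- By Parseval both sides are the same series up to sign, since the multiplier `2πi n_j` is purely
imaginary. No approximation by smooth functions is needed. -/
theorem WDer.ibp {j : Fin 2} {f f' g g' : T2 → ℝ} (hf : WDer (Pi.single j 1) f f')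
    (hg : WDer (Pi.single j 1) g g') :
    ∫ x, f' x * g x ∂torusMeasure = -∫ x, f x * g' x ∂torusMeasure := by
  have h1 := hasSum_fc_mul hf.right hg.left
  have h2 := (hasSum_fc_mul hf.left hg.right).neg
  have h4 : (fun n => -(conj (fc f n) * fc g' n)) = fun n => conj (fc f' n) * fc g n := by
    funext n
    rw [hf.fc_single, hg.fc_single]
    simp only [map_mul, Complex.conj_I, Complex.conj_ofReal, map_ofNat, map_intCast]
    ring
  rw [h4] at h2
  exact_mod_cast h1.unique h2

/-! ### The sup bound for `H²` functions -/

/-- The square summable weight `1 / (1 + 4π²|n|²)`. -/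
def sobWeight (n : Fin 2 → ℤ) : ℝ := (1 + 4 * Real.pi ^ 2 * ((n 0 : ℝ) ^ 2 + (n 1 : ℝ) ^ 2))⁻¹

theorem sobWeight_nonneg (n : Fin 2 → ℤ) : 0 ≤ sobWeight n := by
  unfold sobWeight; positivity

theorem summable_sobWeight_sq : Summable fun n => sobWeight n ^ 2 := by
  have h1 := EisensteinSeries.summable_one_div_norm_rpow (k := 4) (by norm_num)
  -- This summand covers `n = 0`, where the weight is 1 and the comparison with `‖n‖⁻⁴` fails.
  have h2 : Summable fun n : Fin 2 → ℤ => if n = 0 then (1 : ℝ) else 0 :=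
    (hasSum_ite_eq 0 1).summable
  refine Summable.of_nonneg_of_le (fun n => sq_nonneg _) (fun n => ?_) (h1.add h2)
  by_cases hn : n = 0
  · subst hn; simp [sobWeight]
  · have hpos : 0 < ‖n‖ := norm_pos_iff.2 hn
    have hle : ‖n‖ ^ 2 ≤ (n 0 : ℝ) ^ 2 + (n 1 : ℝ) ^ 2 := by
      have : ‖n‖ ≤ √((n 0 : ℝ) ^ 2 + (n 1 : ℝ) ^ 2) := by
        refine (pi_norm_le_iff_of_nonneg (Real.sqrt_nonneg _)).2 fun i => ?_
        refine Real.le_sqrt_of_sq_le ?_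
        fin_cases i <;> simp [Int.norm_eq_abs] <;> positivity
      calc ‖n‖ ^ 2 ≤ _ := pow_le_pow_left₀ hpos.le this 2
        _ = _ := Real.sq_sqrt (by positivity)
    have hpi : 1 ≤ 4 * Real.pi ^ 2 := by nlinarith [Real.pi_gt_three]
    have h3 : sobWeight n ≤ (‖n‖ ^ 2)⁻¹ := by
      unfold sobWeight
      refine inv_anti₀ (by positivity) ?_
      nlinarith [sq_nonneg (n 0 : ℝ), sq_nonneg (n 1 : ℝ)]
    rw [if_neg hn, add_zero]
    calc sobWeight n ^ 2 ≤ ((‖n‖ ^ 2)⁻¹) ^ 2 := pow_le_pow_left₀ (sobWeight_nonneg n) h3 2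
      _ = ‖n‖ ^ (-4 : ℝ) := by
        rw [Real.rpow_neg hpos.le, inv_pow, ← pow_mul]
        norm_cast

/-- The constant of the embedding `H² ⊂ L^∞`. -/
def sobConst : ℝ := √(∑' n, sobWeight n ^ 2)

theorem sobConst_nonneg : 0 ≤ sobConst := Real.sqrt_nonneg _

theorem tsum_sobWeight_mul_fc_le {f : T2 → ℝ} (hf : MemLp f 2 torusMeasure) :
    Summable (fun n => sobWeight n * ‖fc f n‖) ∧
    ∑' n, sobWeight n * ‖fc f n‖ ≤ sobConst * √(∫ x, f x ^ 2 ∂torusMeasure) := by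
  have h1 : Summable fun n => sobWeight n ^ (2 : ℝ) := by simpa using summable_sobWeight_sq
  have h2 : Summable fun n => ‖fc f n‖ ^ (2 : ℝ) := by simpa using (hasSum_fc_sq hf).summable
  have h := Real.inner_le_Lp_mul_Lq_tsum_of_nonneg (p := 2) (q := 2) Real.HolderConjugate.two_two
    (f := sobWeight) (g := fun n => ‖fc f n‖) sobWeight_nonneg (fun n => norm_nonneg _) h1 h2
  refine ⟨Real.summable_mul_of_Lp_Lq_of_nonneg Real.HolderConjugate.two_two sobWeight_nonneg
    (fun n => norm_nonneg _) h1 h2, h.trans_eq ?_⟩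
  simp only [Real.rpow_ofNat, (hasSum_fc_sq hf).tsum_eq, sobConst, Real.sqrt_eq_rpow]

/-- By Cauchy–Schwarz against the square summable weight, the Fourier coefficients are absolutely
summable, so the Fourier series converges uniformly. The `h j` enter only through their
coefficients, so that the bound also applies to `f = ∂_l g` when just the third derivatives of `g`
are at hand. -/
theorem ae_abs_le_of_fc {f : T2 → ℝ} {h : Fin 2 → T2 → ℝ} (hf : MemLp f 2 torusMeasure)
    (hm : ∀ j, MemLp (h j) 2 torusMeasure)
    (hh : ∀ j n, fc (h j) n = -(4 * Real.pi ^ 2 * (n j) ^ 2 : ℝ) * fc f n) :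
    ∀ᵐ x ∂torusMeasure, |f x| ≤ sobConst * (√(∫ x, f x ^ 2 ∂torusMeasure) +
      ∑ j, √(∫ x, h j x ^ 2 ∂torusMeasure)) := by
  obtain ⟨s0, b0⟩ := tsum_sobWeight_mul_fc_le hf
  obtain ⟨s1, b1⟩ := tsum_sobWeight_mul_fc_le (hm 0)
  obtain ⟨s2, b2⟩ := tsum_sobWeight_mul_fc_le (hm 1)
  have hle : ∀ n, ‖fc f n‖ ≤ sobWeight n * ‖fc f n‖ + sobWeight n * ‖fc (h 0) n‖
      + sobWeight n * ‖fc (h 1) n‖ := by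
    intro n
    have hpos : 0 < 1 + 4 * Real.pi ^ 2 * ((n 0 : ℝ) ^ 2 + (n 1 : ℝ) ^ 2) := by positivity
    have e0 : ‖fc (h 0) n‖ = 4 * Real.pi ^ 2 * (n 0 : ℝ) ^ 2 * ‖fc f n‖ := by
      rw [hh 0, norm_mul, norm_neg, Complex.norm_real,
        Real.norm_of_nonneg (by positivity)]
    have e1 : ‖fc (h 1) n‖ = 4 * Real.pi ^ 2 * (n 1 : ℝ) ^ 2 * ‖fc f n‖ := by
      rw [hh 1, norm_mul, norm_neg, Complex.norm_real,
        Real.norm_of_nonneg (by positivity)]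
    refine le_of_eq ?_
    rw [e0, e1, sobWeight]
    field_simp
    ring
  have hsum := (s0.add s1).add s2
  have hs : Summable fun n => ‖fc f n‖ :=
    Summable.of_nonneg_of_le (fun n => norm_nonneg _) hle hsum
  have hb : ∑' n, ‖fc f n‖ ≤ sobConst * (√(∫ x, f x ^ 2 ∂torusMeasure) +
      ∑ j, √(∫ x, h j x ^ 2 ∂torusMeasure)) := by
    refine (hs.tsum_le_tsum hle hsum).trans ?_
    rw [(s0.add s1).tsum_add s2, s0.tsum_add s1, Fin.sum_univ_two]
    linarith
  have hsN : Summable fun n => ‖fc f n • (mFourier n : C(T2, ℂ))‖ := by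
    simpa [norm_smul, mFourier_norm] using hs
  have hsC := hsN.of_norm
  have h1 := hsC.hasSum.mapL (ContinuousMap.toLp (E := ℂ) 2 torusMeasure ℂ)
  simp only [map_smul] at h1
  -- The uniform sum and the `L²` sum of the Fourier series are the same element of `L²`.
  have h2 := h1.unique (hasSum_fc_Lp hf)
  have hn : ‖∑' n, fc f n • (mFourier n : C(T2, ℂ))‖ ≤ ∑' n, ‖fc f n‖ := by
    refine (norm_tsum_le_tsum_norm hsN).trans_eq ?_
    simp [norm_smul, mFourier_norm]
  have h3 := ContinuousMap.coeFn_toLp (p := 2) (𝕜 := ℂ) torusMeasure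
    (∑' n, fc f n • (mFourier n : C(T2, ℂ)))
  rw [h2] at h3
  filter_upwards [h3, toC_coe hf] with x hx hy
  have h4 : ‖(f x : ℂ)‖ ≤ ∑' n, ‖fc f n‖ := by
    rw [← hy, hx]
    exact (ContinuousMap.norm_coe_le_norm _ x).trans hn
  rw [Complex.norm_real, Real.norm_eq_abs] at h4
  exact h4.trans hb

end

/-! ### Calculus of smooth functions on the torus -/

theorem proj_surjective : Function.Surjective proj := fun x =>
  ⟨fun i => (QuotientAddGroup.mk_surjective (x i)).choose,
    funext fun i => (QuotientAddGroup.mk_surjective (x i)).choose_spec⟩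

theorem IsSmooth.hasDerivAt {φ : T2 → ℝ} (hφ : IsSmooth φ) (j : Fin 2) (x : T2) (s : ℝ) :
    HasDerivAt (fun h : ℝ => φ (x + Pi.single j (h : UnitAddCircle)))
      (CalmedMHD.pderiv j φ (x + Pi.single j (s : UnitAddCircle))) s := by
  have hd : DifferentiableAt ℝ (fun h : ℝ => φ (x + Pi.single j (h : UnitAddCircle))) s := by
    obtain ⟨y, rfl⟩ := proj_surjective x
    simp_rw [proj_add_single]
    have h1 : Differentiable ℝ fun y => φ (proj y) := ContDiff.differentiable hφ (by simp)
    have h2 : Differentiable ℝ fun h : ℝ => y + h • (Pi.single j 1 : Fin 2 → ℝ) := by fun_prop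
    exact (h1.comp h2) s
  have h := hd.hasDerivAt
  refine h.congr_deriv ?_
  have h3 : (fun h : ℝ => φ (x + Pi.single j (s : UnitAddCircle) + Pi.single j (h : UnitAddCircle)))
      = fun h : ℝ => (fun h : ℝ => φ (x + Pi.single j (h : UnitAddCircle))) (s + h) := by
    funext h
    simp [add_assoc, ← Pi.single_add]
  unfold CalmedMHD.pderiv
  rw [h3]
  have h4 := deriv_comp_const_add (f := fun h : ℝ => φ (x + Pi.single j (h : UnitAddCircle))) s 0
  rw [add_zero] at h4
  exact h4.symm

theorem IsSmooth.mul {φ ψ : T2 → ℝ} (hφ : IsSmooth φ) (hψ : IsSmooth ψ) :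
    IsSmooth fun x => φ x * ψ x :=
  ContDiff.mul hφ hψ

theorem IsSmooth.pderiv_mul {φ ψ : T2 → ℝ} (hφ : IsSmooth φ) (hψ : IsSmooth ψ) (j : Fin 2)
    (x : T2) : CalmedMHD.pderiv j (fun x => φ x * ψ x) x =
      CalmedMHD.pderiv j φ x * ψ x + φ x * CalmedMHD.pderiv j ψ x := by
  have h := (hφ.hasDerivAt j x 0).mul (hψ.hasDerivAt j x 0)
  simp only [AddCircle.coe_zero, Pi.single_zero, add_zero] at h
  exact h.deriv

theorem IsSmooth.bound {φ : T2 → ℝ} (hφ : IsSmooth φ) : ∃ C, ∀ x, |φ x| ≤ C := by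
  obtain ⟨C, hC⟩ := isCompact_univ.exists_bound_of_continuousOn hφ.continuous.continuousOn
  exact ⟨C, fun x => hC x (mem_univ x)⟩

theorem IsSmooth.memLp {φ : T2 → ℝ} (hφ : IsSmooth φ) (p : ℝ≥0∞) : MemLp φ p torusMeasure := by
  obtain ⟨C, hC⟩ := hφ.bound
  exact MemLp.of_bound hφ.continuous.aestronglyMeasurable C (Filter.Eventually.of_forall hC)

/-- By translation invariance `∫ φ(x + h e_j) dx` does not depend on `h`; differentiate it under the
integral at `h = 0`. -/
theorem IsSmooth.integral_pderiv {φ : T2 → ℝ} (hφ : IsSmooth φ) (j : Fin 2) :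
    ∫ x, CalmedMHD.pderiv j φ x ∂torusMeasure = 0 := by
  obtain ⟨C, hC⟩ := (hφ.pderiv j).bound
  have hcont : ∀ a : T2, Continuous fun x => φ (x + a) := fun a =>
    hφ.continuous.comp (continuous_add_const a)
  have h := hasDerivAt_integral_of_dominated_loc_of_deriv_le (μ := torusMeasure)
    (F := fun (h : ℝ) (x : T2) => φ (x + Pi.single j (h : UnitAddCircle)))
    (F' := fun (h : ℝ) (x : T2) => CalmedMHD.pderiv j φ (x + Pi.single j (h : UnitAddCircle)))
    (x₀ := 0) (s := univ) (bound := fun _ => C) Filter.univ_mem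
    (Filter.Eventually.of_forall fun h => (hcont _).aestronglyMeasurable)
    (by simpa using (hφ.memLp 1).integrable le_rfl)
    (by simpa using (hφ.pderiv j).continuous.aestronglyMeasurable)
    (Filter.Eventually.of_forall fun x h _ => hC _)
    (integrable_const C)
    (Filter.Eventually.of_forall fun x h _ => hφ.hasDerivAt j x h)
  have h2 := h.2
  simp only [integral_add_right_eq_self (μ := torusMeasure) φ] at h2
  have h3 := h2.unique (hasDerivAt_const (0 : ℝ) _)
  simpa using h3

theorem mderiv_single_one (j : Fin 2) (φ : T2 → ℝ) : mderiv (Pi.single j 1) φ = pderiv j φ := by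
  fin_cases j <;> simp [mderiv]

theorem mderiv_single_two (j : Fin 2) (φ : T2 → ℝ) :
    mderiv (Pi.single j 2) φ = pderiv j (pderiv j φ) := by
  fin_cases j <;> simp [mderiv]

/-! ### First-order weak derivatives -/

/-- `f'` is the weak derivative `∂_j f`. -/
abbrev WD (j : Fin 2) (f f' : T2 → ℝ) : Prop := WDer (Pi.single j 1) f f'

theorem WD.mk' {j : Fin 2} {f f' : T2 → ℝ} (hf : MemLp f 2 torusMeasure)
    (hf' : MemLp f' 2 torusMeasure)
    (h : ∀ φ : T2 → ℝ, IsSmooth φ →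
      ∫ x, pderiv j φ x * f x ∂torusMeasure = - ∫ x, φ x * f' x ∂torusMeasure) : WD j f f' :=
  ⟨hf, hf', fun φ hφ => by rw [mderiv_single_one, h φ hφ]; simp⟩

theorem WD.integral_eq {j : Fin 2} {f f' : T2 → ℝ} (h : WD j f f') {φ : T2 → ℝ}
    (hφ : IsSmooth φ) :
    ∫ x, pderiv j φ x * f x ∂torusMeasure = - ∫ x, φ x * f' x ∂torusMeasure := by
  have := h.eq φ hφ
  rw [mderiv_single_one] at this
  simpa using this

theorem IsSmooth.wd {φ : T2 → ℝ} (hφ : IsSmooth φ) (j : Fin 2) : WD j φ (CalmedMHD.pderiv j φ) := by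
  refine WD.mk' (hφ.memLp 2) ((hφ.pderiv j).memLp 2) fun ψ hψ => ?_
  have h := (hψ.mul hφ).integral_pderiv j
  simp_rw [hψ.pderiv_mul hφ j] at h
  rw [integral_add] at h
  · linarith
  · exact (((hψ.pderiv j).mul hφ).memLp 1).integrable le_rfl
  · exact ((hψ.mul (hφ.pderiv j)).memLp 1).integrable le_rfl

theorem integrable_mul {f g : T2 → ℝ} (hf : MemLp f 2 torusMeasure)
    (hg : MemLp g 2 torusMeasure) : Integrable (fun x => f x * g x) torusMeasure :=
  MemLp.integrable_mul hf hg

theorem memLp_bdd_mul {f g : T2 → ℝ} (hf : MemLp f 2 torusMeasure) {C : ℝ}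
    (hC : ∀ᵐ x ∂torusMeasure, |f x| ≤ C) (hg : MemLp g 2 torusMeasure) :
    MemLp (fun x => f x * g x) 2 torusMeasure := by
  refine MemLp.of_le (hg.const_mul C) (hf.1.mul hg.1) ?_
  filter_upwards [hC] with x hx
  rw [norm_mul, norm_mul]
  exact mul_le_mul_of_nonneg_right (hx.trans (le_abs_self C)) (norm_nonneg _)

theorem memLp_mul_bdd {f g : T2 → ℝ} (hf : MemLp f 2 torusMeasure)
    (hg : MemLp g 2 torusMeasure) {C : ℝ} (hC : ∀ᵐ x ∂torusMeasure, |g x| ≤ C) :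
    MemLp (fun x => f x * g x) 2 torusMeasure := by
  simpa only [mul_comm] using memLp_bdd_mul hg hC hf

theorem WDer.congr {α : Fin 2 → ℕ} {f f' g g' : T2 → ℝ} (h : WDer α f f')
    (hf : f =ᵐ[torusMeasure] g) (hf' : f' =ᵐ[torusMeasure] g') : WDer α g g' := by
  refine ⟨(memLp_congr_ae hf).1 h.left, (memLp_congr_ae hf').1 h.right, fun φ hφ => ?_⟩
  rw [← integral_congr_ae (hf.mono fun x hx => by simp only [hx] : (fun x => mderiv α φ x * f x)
      =ᵐ[torusMeasure] fun x => mderiv α φ x * g x),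
    ← integral_congr_ae (hf'.mono fun x hx => by simp only [hx] : (fun x => φ x * f' x)
      =ᵐ[torusMeasure] fun x => φ x * g' x)]
  exact h.eq φ hφ

theorem WDer.sub {α : Fin 2 → ℕ} {f f' g g' : T2 → ℝ} (hf : WDer α f f') (hg : WDer α g g') :
    WDer α (fun x => f x - g x) (fun x => f' x - g' x) := by
  refine ⟨hf.left.sub hg.left, hf.right.sub hg.right, fun φ hφ => ?_⟩
  simp_rw [mul_sub]
  rw [integral_sub (integrable_mul ((hφ.mderiv α).memLp 2) hf.left)
      (integrable_mul ((hφ.mderiv α).memLp 2) hg.left),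
    integral_sub (integrable_mul (hφ.memLp 2) hf.right) (integrable_mul (hφ.memLp 2) hg.right),
    hf.eq φ hφ, hg.eq φ hφ, mul_sub]

/-- If `f' = ∂_j f` and `f'' = ∂_j² f` then `f'' = ∂_j f'`. -/
theorem WD.of_two {j : Fin 2} {f f' f'' : T2 → ℝ} (h1 : WD j f f')
    (h2 : WDer (Pi.single j 2) f f'') : WD j f' f'' := by
  refine WD.mk' h1.right h2.right fun φ hφ => ?_
  have e1 := h1.integral_eq (hφ.pderiv j)
  have e2 := h2.eq φ hφ
  rw [mderiv_single_two] at e2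
  have : ∑ i, (Pi.single j 2 : Fin 2 → ℕ) i = 2 := by simp
  rw [this] at e2
  linarith

theorem WD.smooth_mul {j : Fin 2} {f f' φ : T2 → ℝ} (hφ : IsSmooth φ) (h : WD j f f') :
    WD j (fun x => φ x * f x) (fun x => φ x * f' x + pderiv j φ x * f x) := by
  obtain ⟨C, hC⟩ := hφ.bound
  obtain ⟨C', hC'⟩ := (hφ.pderiv j).bound
  have m1 := memLp_bdd_mul (hφ.memLp 2) (Filter.Eventually.of_forall hC) h.right
  have m2 := memLp_bdd_mul ((hφ.pderiv j).memLp 2) (Filter.Eventually.of_forall hC') h.left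
  have m3 := memLp_bdd_mul (hφ.memLp 2) (Filter.Eventually.of_forall hC) h.left
  refine WD.mk' m3 (m1.add m2) fun ψ hψ => ?_
  have e := h.integral_eq (hψ.mul hφ)
  simp_rw [hψ.pderiv_mul hφ j, add_mul] at e
  have i1 : Integrable (fun x => pderiv j ψ x * φ x * f x) torusMeasure :=
    integrable_mul (((hψ.pderiv j).mul hφ).memLp 2) h.left
  have i2 : Integrable (fun x => ψ x * pderiv j φ x * f x) torusMeasure :=
    integrable_mul ((hψ.mul (hφ.pderiv j)).memLp 2) h.left
  have i3 : Integrable (fun x => ψ x * φ x * f' x) torusMeasure :=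
    integrable_mul ((hψ.mul hφ).memLp 2) h.right
  rw [integral_add i1 i2] at e
  simp only [mul_add, ← mul_assoc]
  rw [integral_add i3 i2]
  linarith

/-- Apply `WDer.ibp` to `φ f` and `g` for a smooth `φ`. The sup bounds on `f` and `g` only serve to
keep the products in `L²`; the derivatives may be unbounded. -/
theorem WD.mul {j : Fin 2} {f f' g g' : T2 → ℝ} (hf : WD j f f') (hg : WD j g g') {C D : ℝ}
    (hC : ∀ᵐ x ∂torusMeasure, |f x| ≤ C) (hD : ∀ᵐ x ∂torusMeasure, |g x| ≤ D) :
    WD j (fun x => f x * g x) (fun x => f' x * g x + f x * g' x) := by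
  have m1 := memLp_bdd_mul hf.left hC hg.left
  have m2 := memLp_bdd_mul hf.left hC hg.right
  have m3 := memLp_mul_bdd hf.right hg.left hD
  refine WD.mk' m1 (m3.add m2) fun φ hφ => ?_
  have e := (hf.smooth_mul hφ).ibp hg
  simp_rw [add_mul] at e
  have i1 : Integrable (fun x => φ x * f' x * g x) torusMeasure := by
    simpa only [mul_assoc] using integrable_mul (hφ.memLp 2) m3
  have i2 : Integrable (fun x => pderiv j φ x * f x * g x) torusMeasure := by
    simpa only [mul_assoc] using integrable_mul ((hφ.pderiv j).memLp 2) m1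
  have i3 : Integrable (fun x => φ x * f x * g' x) torusMeasure := by
    simpa only [mul_assoc] using integrable_mul (hφ.memLp 2) m2
  rw [integral_add i1 i2] at e
  simp only [mul_add, ← mul_assoc]
  rw [integral_add i1 i3]
  linarith

/-- The transport term is antisymmetric when the velocity is divergence free. -/
theorem integral_transport {v v' : Fin 2 → T2 → ℝ} {f g : T2 → ℝ} {f' g' : Fin 2 → T2 → ℝ}
    (hv : ∀ j, WD j (v j) (v' j)) (hdiv : ∀ᵐ x ∂torusMeasure, ∑ j, v' j x = 0)
    (hf : ∀ j, WD j f (f' j)) (hg : ∀ j, WD j g (g' j)) {B C : ℝ}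
    (hB : ∀ j, ∀ᵐ x ∂torusMeasure, |v j x| ≤ B) (hC : ∀ᵐ x ∂torusMeasure, |f x| ≤ C) {D : ℝ}
    (hD : ∀ᵐ x ∂torusMeasure, |g x| ≤ D) :
    Integrable (fun x => ∑ j, (v j x * f' j x * g x + v j x * g' j x * f x)) torusMeasure ∧
    ∫ x, ∑ j, (v j x * f' j x * g x + v j x * g' j x * f x) ∂torusMeasure = 0 := by
  have hi1 : ∀ j, Integrable (fun x => v j x * f' j x * g x) torusMeasure := fun j =>
    integrable_mul (memLp_bdd_mul (hv j).left (hB j) (hf j).right) (hg j).left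
  have hi2 : ∀ j, Integrable (fun x => v j x * g' j x * f x) torusMeasure := fun j =>
    integrable_mul (memLp_bdd_mul (hv j).left (hB j) (hg j).right) (hf j).left
  have hi3 : ∀ j, Integrable (fun x => v' j x * (f x * g x)) torusMeasure := fun j =>
    integrable_mul (hv j).right (memLp_bdd_mul (hf j).left hC (hg j).left)
  have hi4 : ∀ j, Integrable (fun x => v j x * f' j x * g x + v j x * g' j x * f x)
      torusMeasure := fun j => (hi1 j).add (hi2 j)
  refine ⟨integrable_finsetSum _ fun j _ => hi4 j, ?_⟩
  -- The integrand is `v_j ∂_j(f g)`; moving the derivative onto `v_j` makes the divergence appear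
  -- after summation.
  have key : ∀ j, ∫ x, (v j x * f' j x * g x + v j x * g' j x * f x) ∂torusMeasure
      = - ∫ x, v' j x * (f x * g x) ∂torusMeasure := by
    intro j
    have e := (hv j).ibp ((hf j).mul (hg j) hC hD)
    rw [e, neg_neg]
    congr 1; funext x; ring
  rw [integral_finsetSum _ fun j _ => hi4 j]
  simp_rw [key]
  rw [Finset.sum_neg_distrib, ← integral_finsetSum _ fun j _ => hi3 j, neg_eq_zero]
  refine integral_eq_zero_of_ae ?_
  filter_upwards [hdiv] with x hx
  rw [← Finset.sum_mul, hx, zero_mul, Pi.zero_apply]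

/-! ### Scalar components of weak derivatives -/

section Components

variable {E : Type} [NormedAddCommGroup E] [NormedSpace ℝ E]

theorem Sob.isWeakDeriv {k : ℕ} (U : Sob k E) {α : Fin 2 → ℕ} (hα : α ∈ multiIdx k) :
    IsWeakDeriv α (toL2 k E U) (U.1 ⟨α, hα⟩) := U.2 ⟨α, hα⟩

theorem Sob.isWeakDeriv_wderiv {k : ℕ} (U : Sob k E) {α : Fin 2 → ℕ} (hα : α ∈ multiIdx k) :
    IsWeakDeriv α (toL2 k E U) (wderiv α (toL2 k E U)) := by
  have h : ∃ g, IsWeakDeriv α (toL2 k E U) g := ⟨_, Sob.isWeakDeriv U hα⟩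
  rw [wderiv, dif_pos h]
  exact h.choose_spec

theorem mem_multiIdx {k : ℕ} {α : Fin 2 → ℕ} : α ∈ multiIdx k ↔ α 0 + α 1 ≤ k := by
  simp only [multiIdx, Finset.mem_filter, Fintype.mem_piFinset, Finset.mem_range,
    Fin.sum_univ_two, Fin.forall_fin_two]
  omega

theorem single_mem_multiIdx (j : Fin 2) {m k : ℕ} (h : m ≤ k) : Pi.single j m ∈ multiIdx k := by
  rw [mem_multiIdx]; fin_cases j <;> simpa using h

theorem single_add_single_mem_multiIdx (j l : Fin 2) {m n k : ℕ} (h : m + n ≤ k) :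
    Pi.single j m + Pi.single l n ∈ multiIdx k := by
  rw [mem_multiIdx]; fin_cases j <;> fin_cases l <;> simp <;> omega

theorem sqrt_integral_sq_le (f : L2 E) (ℓ : E →L[ℝ] ℝ) (hℓ : ∀ y, |ℓ y| ≤ ‖y‖) :
    √(∫ x, ℓ (f x) ^ 2 ∂torusMeasure) ≤ ‖f‖ := by
  refine Real.sqrt_le_iff.2 ⟨norm_nonneg _, ?_⟩
  have h1 : ‖f‖ ^ 2 = ∫ x, ‖f x‖ ^ 2 ∂torusMeasure := by
    have h2 := Lp.norm_def f
    rw [(Lp.memLp f).eLpNorm_eq_integral_rpow_norm (by norm_num) (by norm_num)] at h2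
    have hnn : 0 ≤ ∫ x, ‖f x‖ ^ (2 : ℝ) ∂torusMeasure := integral_nonneg fun x => by positivity
    simp only [ENNReal.toReal_ofNat] at h2
    rw [ENNReal.toReal_ofReal (by positivity)] at h2
    rw [h2, ← Real.rpow_natCast, ← Real.rpow_mul hnn]
    simp
  rw [h1]
  refine integral_mono_of_nonneg (Filter.Eventually.of_forall fun x => sq_nonneg _)
    ((memLp_two_iff_integrable_sq_norm (Lp.memLp f).1).1 (Lp.memLp f))
    (Filter.Eventually.of_forall fun x => ?_)
  simpa only [sq_abs] using pow_le_pow_left₀ (abs_nonneg _) (hℓ (f x)) 2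

theorem Sob.norm_apply_le {k : ℕ} (U : Sob k E) (α : multiIdx k) : ‖U.1 α‖ ≤ ‖U‖ :=
  PiLp.norm_apply_le U.1 α

variable [CompleteSpace E]

theorem IsWeakDeriv.wder {α : Fin 2 → ℕ} {f g : L2 E} (h : IsWeakDeriv α f g) (ℓ : E →L[ℝ] ℝ) :
    WDer α (fun x => ℓ (f x)) (fun x => ℓ (g x)) := by
  refine ⟨ℓ.comp_memLp f, ℓ.comp_memLp g, fun φ hφ => ?_⟩
  have h1 := congrArg ℓ (h φ hφ)
  rw [map_smul, ← ℓ.integral_comp_comm ((hφ.mderiv α).integrable_smul f),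
    ← ℓ.integral_comp_comm (hφ.integrable_smul g)] at h1
  simpa only [map_smul, smul_eq_mul] using h1

/-- The embedding `H² ⊂ L^∞`. -/
theorem Sob.ae_abs_le {k : ℕ} (hk : 2 ≤ k) (U : Sob k E) (ℓ : E →L[ℝ] ℝ)
    (hℓ : ∀ y, |ℓ y| ≤ ‖y‖) :
    ∀ᵐ x ∂torusMeasure, |ℓ (toL2 k E U x)| ≤ 3 * sobConst * ‖U‖ := by
  have h0 : MemLp (fun x => ℓ (toL2 k E U x)) 2 torusMeasure := ℓ.comp_memLp _
  have hj : ∀ j, WDer (Pi.single j 2) _ _ := fun j =>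
    (Sob.isWeakDeriv U (single_mem_multiIdx j hk)).wder ℓ
  have h := ae_abs_le_of_fc h0 (fun j => (hj j).right) (fun j n => by
    rw [(hj j).fc_eq]
    fin_cases j <;> simp [mul_pow] <;> ring_nf <;> simp)
  refine h.mono fun x hx => hx.trans ?_
  -- The three `L²` norms (the function and its two pure second derivatives) are each at most `‖U‖`,
  -- whence the factor 3.
  have a0 := (sqrt_integral_sq_le (toL2 k E U) ℓ hℓ).trans
    (Sob.norm_apply_le U ⟨0, zero_mem_multiIdx k⟩)
  have aj := fun j => (sqrt_integral_sq_le _ ℓ hℓ).trans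
    (Sob.norm_apply_le U ⟨_, single_mem_multiIdx j hk⟩)
  rw [Fin.sum_univ_two, mul_comm 3, mul_assoc]
  refine mul_le_mul_of_nonneg_left ?_ sobConst_nonneg
  linarith [aj 0, aj 1]

theorem Sob.wd_wder {k : ℕ} (hk : 1 ≤ k) (U : Sob k E) (ℓ : E →L[ℝ] ℝ) (j : Fin 2) :
    WD j (fun x => ℓ (toL2 k E U x)) (fun x => ℓ (wd j (toL2 k E U) x)) :=
  (Sob.isWeakDeriv_wderiv U (single_mem_multiIdx j hk)).wder ℓ

theorem Sob.wderiv_two_wder {k : ℕ} (hk : 2 ≤ k) (U : Sob k E) (ℓ : E →L[ℝ] ℝ) (j : Fin 2) :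
    WDer (Pi.single j 2) (fun x => ℓ (toL2 k E U x))
      (fun x => ℓ (wderiv (Pi.single j 2) (toL2 k E U) x)) :=
  (Sob.isWeakDeriv_wderiv U (single_mem_multiIdx j hk)).wder ℓ

/-- The embedding `H³ ⊂ W^{1,∞}`. -/
theorem Sob.ae_abs_wd_le {k : ℕ} (hk : 3 ≤ k) (U : Sob k E) (ℓ : E →L[ℝ] ℝ)
    (hℓ : ∀ y, |ℓ y| ≤ ‖y‖) (j : Fin 2) :
    ∀ᵐ x ∂torusMeasure, |ℓ (wd j (toL2 k E U) x)| ≤ 3 * sobConst * ‖U‖ := by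
  have hj := (Sob.isWeakDeriv U (single_mem_multiIdx j (by omega : 1 ≤ k))).wder ℓ
  have heq := (Sob.wd_wder (by omega) U ℓ j).unique hj
  -- `∂_j ∂_l² U` plays the part of the second derivative of `∂_j U`: its Fourier coefficients are
  -- the right ones.
  have hjl : ∀ l, WDer (Pi.single j 1 + Pi.single l 2) _ _ := fun l =>
    (Sob.isWeakDeriv U (single_add_single_mem_multiIdx j l (by omega : 1 + 2 ≤ k))).wder ℓ
  have h := ae_abs_le_of_fc hj.right (fun l => (hjl l).right) (fun l n => by
    rw [(hjl l).fc_eq, hj.fc_eq]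
    fin_cases j <;> fin_cases l <;> simp [mul_pow] <;> ring_nf)
  filter_upwards [h, heq] with x hx hxe
  rw [hxe]
  refine hx.trans ?_
  have a0 := (sqrt_integral_sq_le _ ℓ hℓ).trans
    (Sob.norm_apply_le U ⟨_, single_mem_multiIdx j (by omega : 1 ≤ k)⟩)
  have aj := fun l => (sqrt_integral_sq_le _ ℓ hℓ).trans
    (Sob.norm_apply_le U ⟨_, single_add_single_mem_multiIdx j l (by omega : 1 + 2 ≤ k)⟩)
  rw [Fin.sum_univ_two, mul_comm 3, mul_assoc]
  refine mul_le_mul_of_nonneg_left ?_ sobConst_nonneg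
  linarith [aj 0, aj 1]

end Components

/-! ### Divergence-free fields -/

theorem abs_proj_le (i : Fin 2) (y : Vec) : |(EuclideanSpace.proj i : Vec →L[ℝ] ℝ) y| ≤ ‖y‖ :=
  PiLp.norm_apply_le y i

theorem spaceV_le_spaceH : spaceV ≤ spaceH := by
  have h : spaceV1 ≤ spaceH.comap (toL2 1 Vec).toLinearMap := by
    refine Submodule.topologicalClosure_minimal _ ?_ ?_
    · rw [Submodule.span_le]
      intro F hF
      exact Submodule.le_topologicalClosure _ (Submodule.subset_span hF)
    · exact (Submodule.isClosed_topologicalClosure _).preimage (toL2 1 Vec).continuous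
  exact Submodule.map_le_iff_le_comap.2 h

theorem isSmooth_trigPoly (F : Finset (Fin 2 → ℤ)) (c : (Fin 2 → ℤ) → Fin 2 → ℂ) (j : Fin 2) :
    IsSmooth fun x => trigPoly F c x j := by
  have : (fun x => trigPoly F c x j) = fun x => ∑ k ∈ F, trigMon k (c k j) x := by
    funext x; simp [trigPoly, trigMon]
  rw [this]
  unfold IsSmooth
  exact ContDiff.sum fun k _ => isSmooth_trigMon k (c k j)

theorem inner_vec_eq (f g : L2 Vec) :
    inner ℝ f g = ∫ x, ∑ i, f x i * g x i ∂torusMeasure := by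
  rw [L2.inner_def]
  refine integral_congr_ae (Filter.Eventually.of_forall fun x => ?_)
  simp [PiLp.inner_apply, mul_comm]

/-- The gradient of a smooth function, in `L²`. -/
def gradL2 {ψ : T2 → ℝ} (hψ : IsSmooth ψ) : L2 Vec :=
  MemLp.toLp (fun x => WithLp.toLp 2 fun j => pderiv j ψ x) (by
    rw [memLp_piLp_iff]
    exact fun j => (hψ.pderiv j).memLp 2)

theorem inner_gradL2 {ψ : T2 → ℝ} (hψ : IsSmooth ψ) (v : L2 Vec) :
    inner ℝ (gradL2 hψ) v = ∫ x, ∑ j, pderiv j ψ x * v x j ∂torusMeasure := by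
  rw [inner_vec_eq]
  refine integral_congr_ae ?_
  filter_upwards [MemLp.coeFn_toLp (μ := torusMeasure) (p := 2)
    (f := fun x => (WithLp.toLp 2 fun j => pderiv j ψ x : Vec)) _] with x hx
  have : gradL2 hψ x = WithLp.toLp 2 fun j => pderiv j ψ x := hx
  simp [this]

/-- Integration by parts gives orthogonality to divergence-free trigonometric polynomials, and being
orthogonal to a fixed gradient is a closed linear condition. -/
theorem inner_gradL2_eq_zero {ψ : T2 → ℝ} (hψ : IsSmooth ψ) {v : L2 Vec} (hv : v ∈ spaceH) :
    inner ℝ (gradL2 hψ) v = 0 := by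
  have h : spaceH ≤ LinearMap.ker (innerSL ℝ (gradL2 hψ)).toLinearMap := by
    refine Submodule.topologicalClosure_minimal _ ?_ (ContinuousLinearMap.isClosed_ker _)
    rw [Submodule.span_le]
    rintro v ⟨F, c, hvF, hdiv, -⟩
    change inner ℝ (gradL2 hψ) v = 0
    have hs := isSmooth_trigPoly F c
    rw [inner_gradL2]
    have e1 : ∫ x, ∑ j, pderiv j ψ x * v x j ∂torusMeasure
        = ∫ x, ∑ j, pderiv j ψ x * trigPoly F c x j ∂torusMeasure := by
      refine integral_congr_ae (hvF.mono fun x hx => ?_)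
      simp only [hx]
    have i1 : ∀ j, Integrable (fun x => pderiv j ψ x * trigPoly F c x j) torusMeasure :=
      fun j => integrable_mul ((hψ.pderiv j).memLp 2) ((hs j).memLp 2)
    have i2 : ∀ j, Integrable (fun x => ψ x * pderiv j (fun y => trigPoly F c y j) x)
        torusMeasure :=
      fun j => integrable_mul (hψ.memLp 2) (((hs j).pderiv j).memLp 2)
    rw [e1, integral_finsetSum _ fun j _ => i1 j]
    simp_rw [fun j => ((hs j).wd j).integral_eq hψ]
    rw [Finset.sum_neg_distrib, ← integral_finsetSum _ fun j _ => i2 j, neg_eq_zero]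
    refine integral_eq_zero_of_ae (Filter.Eventually.of_forall fun x => ?_)
    simp only [← Finset.mul_sum, hdiv x, mul_zero, Pi.zero_apply]
  exact h hv

theorem ae_div_eq_zero {k : ℕ} (hk : 1 ≤ k) (U : Sob k Vec) (hU : toL2 k Vec U ∈ spaceH) :
    ∀ᵐ x ∂torusMeasure, ∑ j, wd j (toL2 k Vec U) x j = 0 := by
  have hw : ∀ j, WD j (fun x => toL2 k Vec U x j) (fun x => wd j (toL2 k Vec U) x j) := fun j =>
    Sob.wd_wder hk U (EuclideanSpace.proj j) j
  have hm : MemLp (fun x => ∑ j, wd j (toL2 k Vec U) x j) 2 torusMeasure :=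
    memLp_finsetSum _ fun j _ => (hw j).right
  -- Orthogonality to all gradients says that the divergence is a weak derivative of order zero of
  -- the zero function, so `WDer.unique` makes it vanish.
  have h : WDer 0 (fun _ => (0 : ℝ)) (fun x => ∑ j, wd j (toL2 k Vec U) x j) := by
    refine ⟨MemLp.zero, hm, fun φ hφ => ?_⟩
    have h1 := inner_gradL2_eq_zero hφ hU
    rw [inner_gradL2, integral_finsetSum _ fun j _ =>
      integrable_mul ((hφ.pderiv j).memLp 2) (hw j).left] at h1
    simp_rw [fun j => (hw j).integral_eq hφ] at h1
    simp_rw [Finset.mul_sum]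
    rw [integral_finsetSum _ fun j _ => integrable_mul (hφ.memLp 2) (hw j).right]
    rw [Finset.sum_neg_distrib] at h1
    simp only [mul_zero, integral_zero]
    rw [neg_eq_zero.1 h1, mul_zero]
  have h0 : WDer 0 (fun _ => (0 : ℝ)) (fun _ => (0 : ℝ)) :=
    ⟨MemLp.zero, MemLp.zero, fun φ _ => by simp⟩
  exact h.unique h0

/-! ### Completeness of `H^k` -/

theorem integral_mul_eq_inner {φ : T2 → ℝ} (hφ : IsSmooth φ) (f : L2 ℝ) :
    ∫ x, φ x • f x ∂torusMeasure = inner ℝ ((hφ.memLp 2).toLp φ) f := by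
  rw [L2.inner_def]
  refine integral_congr_ae ?_
  filter_upwards [MemLp.coeFn_toLp (hφ.memLp 2)] with x hx
  simp [hx, mul_comm]

/-- Each weak-derivative relation equates two continuous functionals, so `H^k` is closed in a finite
product of copies of `L²`. Completeness of `H¹` is used by the Lax–Milgram and Riesz theorems in the
energy identity for `θ`. -/
instance (k : ℕ) : CompleteSpace (Sob k ℝ) := by
  refine IsClosed.completeSpace_coe (hs := ?_)
  have : ((Sob k ℝ) : Set (PiLp 2 fun _ : multiIdx k => L2 ℝ)) =
      ⋂ (α : multiIdx k) (φ : T2 → ℝ) (hφ : IsSmooth φ),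
        {F : PiLp 2 fun _ : multiIdx k => L2 ℝ | inner ℝ (((hφ.mderiv α).memLp 2).toLp (mderiv α φ)) (F ⟨0, zero_mem_multiIdx k⟩)
          = (-1 : ℝ) ^ (∑ i, (α : Fin 2 → ℕ) i) • inner ℝ ((hφ.memLp 2).toLp φ) (F α)} := by
    ext F
    simp only [mem_iInter, mem_ofPred_eq]
    constructor
    · intro h α φ hφ
      rw [← integral_mul_eq_inner (hφ.mderiv α), ← integral_mul_eq_inner hφ]
      exact h α φ hφ
    · intro h α φ hφ
      have := h α φ hφ
      rwa [← integral_mul_eq_inner (hφ.mderiv α), ← integral_mul_eq_inner hφ] at this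
  rw [this]
  refine isClosed_iInter fun α => isClosed_iInter fun φ => isClosed_iInter fun hφ => ?_
  refine isClosed_eq ?_ ?_ <;> fun_prop

section

open Filter Topology

/-! ### Absolute continuity and Gronwall's inequality -/

theorem absolutelyContinuousOnInterval_of_dist_le {X Y : Type*} [PseudoMetricSpace X]
    [PseudoMetricSpace Y] {f : ℝ → X} {g : ℝ → Y} {a b C : ℝ}
    (hg : AbsolutelyContinuousOnInterval g a b)
    (h : ∀ s ∈ uIcc a b, ∀ t ∈ uIcc a b, dist (f s) (f t) ≤ C * dist (g s) (g t)) :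
    AbsolutelyContinuousOnInterval f a b := by
  rw [absolutelyContinuousOnInterval_iff] at hg ⊢
  intro ε hε
  -- Dividing by `|C| + 1` avoids any sign condition on `C`.
  obtain ⟨δ, hδ, H⟩ := hg (ε / (|C| + 1)) (by positivity)
  refine ⟨δ, hδ, fun E hE hEδ => ?_⟩
  have h1 := H E hE hEδ
  rw [lt_div_iff₀ (by positivity)] at h1
  refine lt_of_le_of_lt ?_ h1
  rw [Finset.sum_mul]
  refine Finset.sum_le_sum fun i hi => ?_
  have hm := hE.1 i hi
  refine (h _ hm.1 _ hm.2).trans ?_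
  rw [mul_comm]
  exact mul_le_mul_of_nonneg_left (by linarith [le_abs_self C]) dist_nonneg

/-- The primitive of an integrable vector function is absolutely continuous. -/
theorem absolutelyContinuousOnInterval_primitive {X : Type*} [NormedAddCommGroup X]
    [NormedSpace ℝ X] {F : ℝ → X} {T : ℝ} (hF : IntervalIntegrable F volume 0 T) :
    AbsolutelyContinuousOnInterval (fun t => ∫ s in (0 : ℝ)..t, F s) 0 T := by
  have hn := hF.norm.absolutelyContinuousOnInterval_intervalIntegral (c := 0) (by simp)
  refine absolutelyContinuousOnInterval_of_dist_le (C := 1) hn fun s hs t ht => ?_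
  have hsub : ∀ r ∈ uIcc 0 T, IntervalIntegrable F volume 0 r := fun r hr =>
    hF.mono_set (uIcc_subset_uIcc left_mem_uIcc hr)
  rw [dist_eq_norm, intervalIntegral.integral_interval_sub_left (hsub s hs) (hsub t ht),
    Real.dist_eq, intervalIntegral.integral_interval_sub_left (hsub s hs).norm (hsub t ht).norm,
    one_mul]
  exact intervalIntegral.norm_integral_le_abs_integral_norm

/-- `A` is merely integrable, so the usual proof is run with absolutely continuous functions: `y(t)
exp(-∫₀ᵗ A)` has a nonpositive derivative almost everywhere. -/
theorem gronwall_integral {T : ℝ} (hT : 0 ≤ T) {y G A : ℝ → ℝ}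
    (hG : IntervalIntegrable G volume 0 T) (hA : IntervalIntegrable A volume 0 T)
    (hA0 : ∀ᵐ t ∂volume.restrict (Ioo 0 T), 0 ≤ A t)
    (hy : ∀ t ∈ Icc 0 T, y t = y 0 + ∫ s in (0 : ℝ)..t, G s) (hy0 : 0 ≤ y 0)
    (hGA : ∀ᵐ t ∂volume.restrict (Ioo 0 T), G t ≤ A t * y t) :
    ∀ t ∈ Icc 0 T, y t ≤ Real.exp (∫ s in (0 : ℝ)..T, A s) * y 0 := by
  intro t ht
  set Y : ℝ → ℝ := fun t => y 0 + ∫ s in (0 : ℝ)..t, G s with hY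
  set B : ℝ → ℝ := fun t => ∫ s in (0 : ℝ)..t, A s with hB
  have acB : AbsolutelyContinuousOnInterval B 0 T :=
    absolutelyContinuousOnInterval_primitive hA
  have acY : AbsolutelyContinuousOnInterval Y 0 T := by
    refine absolutelyContinuousOnInterval_of_dist_le (C := 1)
      (absolutelyContinuousOnInterval_primitive hG) fun s _ t _ => ?_
    simp [hY]
  have acE : AbsolutelyContinuousOnInterval (fun t => Real.exp (-B t)) 0 T := by
    obtain ⟨C, hC⟩ := acB.exists_bound
    -- The exponential is Lipschitz on the bounded range of `B`, so composing with it preserves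
    -- absolute continuity.
    have hl : ∃ K, LipschitzOnWith K (fun x => Real.exp (-x)) (Icc (-C) C) :=
      ContDiffOn.exists_lipschitzOnWith (n := 1) (by fun_prop) (by decide) (convex_Icc _ _)
        isCompact_Icc
    obtain ⟨K, hK⟩ := hl
    refine absolutelyContinuousOnInterval_of_dist_le (C := K) acB fun s hs t ht => ?_
    exact hK.dist_le_mul _ (abs_le.1 (hC s hs)) _ (abs_le.1 (hC t ht))
  have hsubT : uIcc 0 t ⊆ uIcc 0 T := by
    rw [uIcc_of_le ht.1, uIcc_of_le hT]; exact Icc_subset_Icc_right ht.2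
  have acZ := (acY.fun_mul acE).mono hsubT
  have hz := acZ.integral_deriv_eq_sub
  have hle : ∫ x in (0 : ℝ)..t, deriv (fun t => Y t * Real.exp (-B t)) x ≤ 0 := by
    rw [intervalIntegral.integral_of_le ht.1, integral_Ioc_eq_integral_Ioo]
    refine integral_nonpos_of_ae ?_
    have hsub : Ioo 0 t ⊆ Ioo 0 T := Ioo_subset_Ioo_right ht.2
    filter_upwards [ae_restrict_of_ae_restrict_of_subset hsub hGA,
      ae_restrict_of_ae hG.ae_hasDerivAt_integral, ae_restrict_of_ae hA.ae_hasDerivAt_integral,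
      ae_restrict_mem measurableSet_Ioo] with x h1 h2 h3 hx
    have hxI : x ∈ uIcc 0 T := by
      rw [uIcc_of_le hT]; exact Ioo_subset_Icc_self (hsub hx)
    have d1 : HasDerivAt Y (G x) x := (h2 hxI 0 (by simp)).const_add _
    have d2 : HasDerivAt B (A x) x := h3 hxI 0 (by simp)
    have d3 := d1.mul d2.neg.exp
    have d4 : deriv (fun t => Y t * Real.exp (-B t)) x = _ := d3.deriv
    have hyx : y x = Y x := hy x (Ioo_subset_Icc_self (hsub hx))
    rw [hyx] at h1
    rw [d4, Pi.zero_apply]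
    simp only [Pi.neg_apply]
    nlinarith [Real.exp_pos (-B x)]
  rw [hz] at hle
  have hB0 : B 0 = 0 := by simp [hB]
  have hY0 : Y 0 = y 0 := by simp [hY]
  rw [hB0, hY0, neg_zero, Real.exp_zero, mul_one] at hle
  have h1 : Y t ≤ Real.exp (B t) * y 0 := by
    have h2 : Y t * Real.exp (-B t) ≤ y 0 := by linarith
    calc Y t = Real.exp (B t) * (Y t * Real.exp (-B t)) := by
          rw [mul_left_comm, ← Real.exp_add]; simp
      _ ≤ _ := mul_le_mul_of_nonneg_left h2 (Real.exp_pos _).le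
  rw [hy t ht]
  refine h1.trans (mul_le_mul_of_nonneg_right (Real.exp_le_exp.2 ?_) hy0)
  refine intervalIntegral.integral_mono_interval le_rfl ht.1 ht.2 ?_ hA
  rw [← Measure.restrict_congr_set Ioo_ae_eq_Ioc]
  exact hA0

/-! ### Weak time derivatives -/

theorem exists_smooth_bump {T : ℝ} (hT : 0 < T) : ∃ ρ : ℝ → ℝ, ContDiff ℝ ∞ ρ ∧
    HasCompactSupport ρ ∧ tsupport ρ ⊆ Ioo 0 T ∧ ∫ t, ρ t = 1 := by
  let f : ContDiffBump (T / 2) := ⟨T / 8, T / 4, by positivity, by linarith⟩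
  refine ⟨f.normed volume, f.contDiff_normed, f.hasCompactSupport_normed, ?_, f.integral_normed⟩
  rw [f.tsupport_normed_eq, Real.closedBall_eq_Icc]
  exact fun x hx => ⟨by have := hx.1; simp only [f] at this; linarith,
    by have := hx.2; simp only [f] at this; linarith⟩

/-- A test function of zero mean is the derivative of a test function. -/
theorem exists_primitive_test {T : ℝ} {χ : ℝ → ℝ} (hχ : ContDiff ℝ ∞ χ)
    (hc : HasCompactSupport χ) (hs : tsupport χ ⊆ Ioo 0 T) (h0 : ∫ t, χ t = 0) :
    ∃ φ : ℝ → ℝ, ContDiff ℝ ∞ φ ∧ HasCompactSupport φ ∧ tsupport φ ⊆ Ioo 0 T ∧ deriv φ = χ := by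
  have hd : ∀ t, HasDerivAt (fun t => ∫ s in (0 : ℝ)..t, χ s) (χ t) t := fun t =>
    intervalIntegral.integral_hasDerivAt_right (hχ.continuous.intervalIntegrable _ _)
      (hχ.continuous.stronglyMeasurableAtFilter _ _) hχ.continuous.continuousAt
  have hder : deriv (fun t => ∫ s in (0 : ℝ)..t, χ s) = χ := funext fun t => (hd t).deriv
  by_cases hne : (tsupport χ).Nonempty
  swap
  · have hz : χ = 0 := tsupport_eq_empty_iff.1 (not_nonempty_iff_eq_empty.1 hne)
    refine ⟨0, contDiff_const, HasCompactSupport.zero, by simp, ?_⟩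
    rw [hz]; funext t; simp
  obtain ⟨a, ha⟩ := hc.isCompact.exists_isLeast hne
  obtain ⟨b, hb⟩ := hc.isCompact.exists_isGreatest hne
  have hz1 : ∀ t, t < a → χ t = 0 := fun t ht => by
    by_contra hne
    exact absurd (ha.2 (subset_tsupport χ hne)) (by linarith)
  have hz2 : ∀ t, b < t → χ t = 0 := fun t ht => by
    by_contra hne
    exact absurd (hb.2 (subset_tsupport χ hne)) (by linarith)
  have ha0 := hs ha.1
  have hb0 := hs hb.1
  -- The primitive vanishes to the left of the support because `χ` does, and to the right because
  -- `χ` has zero mean.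
  have hsub : tsupport (fun t => ∫ s in (0 : ℝ)..t, χ s) ⊆ Icc a b := by
    refine closure_minimal (fun t ht => ?_) isClosed_Icc
    by_contra hcon
    apply ht
    rcases not_and_or.1 hcon with h | h
    · change ∫ s in (0 : ℝ)..t, χ s = 0
      refine intervalIntegral.integral_zero_ae (Eventually.of_forall fun s hs' => hz1 s ?_)
      have := hs'.2
      exact lt_of_le_of_lt this (max_lt ha0.1 (not_le.1 h))
    · have h' := not_le.1 h
      change ∫ s in (0 : ℝ)..t, χ s = 0
      have ht0 : 0 ≤ t := by linarith [hb0.1]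
      rw [intervalIntegral.integral_of_le ht0, setIntegral_eq_integral_of_forall_compl_eq_zero, h0]
      intro s hs'
      by_cases h1 : s ≤ 0
      · exact hz1 s (by linarith [ha0.1])
      · exact hz2 s (by
          by_contra h2
          exact hs' ⟨not_le.1 h1, by linarith⟩)
  refine ⟨_, ?_, HasCompactSupport.of_support_subset_isCompact isCompact_Icc
    (subset_closure.trans hsub), hsub.trans (Icc_subset_Ioo ha0.1 hb0.2), hder⟩
  rw [contDiff_infty_iff_deriv, hder]
  exact ⟨fun t => (hd t).differentiableAt, hχ⟩

/-- A continuous function whose weak derivative vanishes is constant. -/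
theorem const_of_weak_deriv_zero {T : ℝ} (hT : 0 < T) {h : ℝ → ℝ} (hh : ContinuousOn h (Icc 0 T))
    (hz : ∀ φ : ℝ → ℝ, ContDiff ℝ ∞ φ → HasCompactSupport φ → tsupport φ ⊆ Ioo 0 T →
      ∫ t in Ioo 0 T, deriv φ t * h t = 0) : ∀ t ∈ Icc 0 T, h t = h 0 := by
  obtain ⟨ρ, hρ, hρc, hρs, hρ1⟩ := exists_smooth_bump hT
  set c := ∫ t in Ioo 0 T, ρ t * h t with hc
  have hint : IntegrableOn h (Icc 0 T) := hh.integrableOn_Icc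
  have hmul : ∀ ψ : ℝ → ℝ, Continuous ψ → IntegrableOn (fun t => ψ t * h t) (Ioo 0 T) :=
    fun ψ hψ => ((hψ.continuousOn.mul hh).integrableOn_Icc).mono_set Ioo_subset_Icc_self
  have hae : ∀ᵐ t, t ∈ Ioo 0 T → h t - c = 0 := by
    refine isOpen_Ioo.ae_eq_zero_of_integral_contDiff_smul_eq_zero
      (((hint.mono_set Ioo_subset_Icc_self).sub
        (integrableOn_const (by simp))).locallyIntegrableOn) fun ψ hψ hψc hψs => ?_
    -- Subtracting `m ρ` gives `ψ` zero mean, so the difference is the derivative of a test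
    -- function; hence `∫ ψ (h - c) = 0` for every `ψ`.
    set m := ∫ t, ψ t with hm
    obtain ⟨φ, h1, h2, h3, h4⟩ := exists_primitive_test (T := T) (χ := fun t => ψ t - m * ρ t)
      (by fun_prop) (hψc.sub hρc.mul_left)
      ((tsupport_sub _ _).trans (union_subset hψs ((tsupport_mul_subset_right).trans hρs)))
      (by
        rw [integral_sub (hψ.continuous.integrable_of_hasCompactSupport hψc)
          ((hρ.continuous.integrable_of_hasCompactSupport hρc).const_mul m), integral_const_mul,
          hρ1, mul_one, sub_self])
    have h5 := hz φ h1 h2 h3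
    rw [h4] at h5
    simp_rw [sub_mul, mul_assoc] at h5
    rw [integral_sub (hmul ψ hψ.continuous) ((hmul ρ hρ.continuous).const_mul m),
      integral_const_mul, ← hc] at h5
    have hout : ∀ t, t ∉ Ioo 0 T → ψ t = 0 := fun t ht =>
      image_eq_zero_of_notMem_tsupport fun hmem => ht (hψs hmem)
    rw [← setIntegral_eq_integral_of_forall_compl_eq_zero (s := Ioo 0 T)
      (fun t ht => by rw [hout t ht, zero_smul])]
    have hmI : m = ∫ t in Ioo 0 T, ψ t :=
      (setIntegral_eq_integral_of_forall_compl_eq_zero hout).symm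
    simp_rw [smul_eq_mul, mul_sub]
    rw [integral_sub (hmul ψ hψ.continuous)
      (((hψ.continuous.integrable_of_hasCompactSupport hψc).mul_const c).integrableOn),
      integral_mul_const, ← hmI]
    exact h5
  have hIoo : EqOn h (fun _ => c) (Ioo 0 T) := by
    refine Measure.eqOn_open_of_ae_eq (μ := volume) ?_ isOpen_Ioo
      (hh.mono Ioo_subset_Icc_self) continuousOn_const
    rw [EventuallyEq, ae_restrict_iff' measurableSet_Ioo]
    exact hae.mono fun t ht hmem => sub_eq_zero.1 (ht hmem)
  have hIcc : EqOn h (fun _ => c) (Icc 0 T) := by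
    have := hIoo.of_subset_closure hh continuousOn_const Ioo_subset_Icc_self
      (by rw [closure_Ioo hT.ne])
    exact this
  intro t ht
  rw [hIcc ht, hIcc (left_mem_Icc.2 hT.le)]

end

section

open Filter Topology

/-- A continuous function with an integrable weak derivative is the primitive of this derivative. -/
theorem IsTimeDeriv.eq_add_integral {X : Type} [NormedAddCommGroup X] [NormedSpace ℝ X]
    [CompleteSpace X] {T : ℝ} (hT : 0 < T) {f F : ℝ → X} (hf : ContinuousOn f (Icc 0 T))
    (hF : IntegrableOn F (Ioo 0 T)) (hd : IsTimeDeriv T f F) :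
    ∀ t ∈ Icc 0 T, f t = f 0 + ∫ s in (0 : ℝ)..t, F s := by
  intro t ht
  have hFI : IntervalIntegrable F volume 0 T := by
    rw [intervalIntegrable_iff_integrableOn_Ioo_of_le hT.le]; exact hF
  refine (SeparatingDual.eq_iff_forall_dual_eq (R := ℝ)).2 fun l => ?_
  have hlF : IntervalIntegrable (fun s => l (F s)) volume 0 T :=
    ⟨l.integrable_comp hFI.1, l.integrable_comp hFI.2⟩
  have acP := absolutelyContinuousOnInterval_primitive hlF
  have hPc := acP.continuousOn
  rw [uIcc_of_le hT.le] at hPc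
  have hlf : ContinuousOn (fun t => l (f t)) (Icc 0 T) := l.continuous.comp_continuousOn hf
  -- Through a functional `l` the claim is scalar: `l ∘ f` minus the primitive of `l ∘ F` has zero
  -- weak derivative, by integration by parts for absolutely continuous functions.
  have key := const_of_weak_deriv_zero hT (hlf.sub hPc) (fun φ hφ hφc hφs => by
    have hφ' : Continuous (deriv φ) := hφ.continuous_deriv (by simp)
    have i1 : IntegrableOn (fun t => deriv φ t * l (f t)) (Ioo 0 T) :=
      ((hφ'.continuousOn.mul hlf).integrableOn_Icc).mono_set Ioo_subset_Icc_self
    have i2 : IntegrableOn (fun t => deriv φ t * ∫ s in (0 : ℝ)..t, l (F s)) (Ioo 0 T) :=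
      ((hφ'.continuousOn.mul hPc).integrableOn_Icc).mono_set Ioo_subset_Icc_self
    have i3 : IntegrableOn (fun t => deriv φ t • f t) (Ioo 0 T) :=
      ((hφ'.continuousOn.smul hf).integrableOn_Icc).mono_set Ioo_subset_Icc_self
    have i4 : IntegrableOn (fun t => φ t • F t) (Ioo 0 T) := by
      obtain ⟨C, hC⟩ := hφc.exists_bound_of_continuous hφ.continuous
      exact hF.bdd_smul C hφ.continuous.aestronglyMeasurable (Eventually.of_forall hC)
    have e1 := congrArg l (hd φ hφ hφc hφs)
    rw [map_neg, ← l.integral_comp_comm i3, ← l.integral_comp_comm i4] at e1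
    simp only [map_smul, smul_eq_mul] at e1
    simp_rw [Pi.sub_apply, mul_sub]
    rw [integral_sub i1 i2, e1]
    have acφ : AbsolutelyContinuousOnInterval φ 0 T :=
      (hφ.of_le (by simp)).contDiffOn.absolutelyContinuousOnInterval
    have e2 := acP.integral_mul_deriv_eq_deriv_mul acφ
    have hφ0 : φ 0 = 0 := image_eq_zero_of_notMem_tsupport fun h => lt_irrefl _ (hφs h).1
    have hφT : φ T = 0 := image_eq_zero_of_notMem_tsupport fun h => lt_irrefl _ (hφs h).2
    rw [hφ0, hφT, mul_zero, mul_zero, sub_zero, zero_sub, intervalIntegral.integral_of_le hT.le,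
      intervalIntegral.integral_of_le hT.le, integral_Ioc_eq_integral_Ioo,
      integral_Ioc_eq_integral_Ioo] at e2
    have e3 : ∫ t in Ioo 0 T, deriv (fun t => ∫ s in (0 : ℝ)..t, l (F s)) t * φ t
        = ∫ t in Ioo 0 T, φ t * l (F t) := by
      refine integral_congr_ae ?_
      filter_upwards [ae_restrict_of_ae hlF.ae_hasDerivAt_integral,
        ae_restrict_mem measurableSet_Ioo] with t h1 h2
      have hmem : t ∈ uIcc 0 T := by rw [uIcc_of_le hT.le]; exact Ioo_subset_Icc_self h2
      rw [(h1 hmem 0 (by simp)).deriv, mul_comm]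
    have e4 : ∫ t in Ioo 0 T, deriv φ t * ∫ s in (0 : ℝ)..t, l (F s)
        = ∫ t in Ioo 0 T, (∫ s in (0 : ℝ)..t, l (F s)) * deriv φ t := by simp_rw [mul_comm]
    rw [e4, e2, e3]; ring) t ht
  have hFt : IntervalIntegrable F volume 0 t :=
    hFI.mono_set (by rw [uIcc_of_le ht.1, uIcc_of_le hT.le]; exact Icc_subset_Icc_right ht.2)
  rw [map_add, ← l.intervalIntegral_comp_comm hFt]
  simp only [Pi.sub_apply, intervalIntegral.integral_same, sub_zero] at key
  linarith

/-- The chain rule for a symmetric bilinear form along an absolutely continuous curve. -/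
theorem bilin_self_eq_add_integral {X : Type} [NormedAddCommGroup X] [NormedSpace ℝ X]
    [CompleteSpace X] {T : ℝ} (hT : 0 < T) {f F : ℝ → X} (hF : IntervalIntegrable F volume 0 T)
    (hf : ∀ t ∈ Icc 0 T, f t = f 0 + ∫ s in (0 : ℝ)..t, F s) (B : X →L[ℝ] X →L[ℝ] ℝ)
    (hB : ∀ x y, B x y = B y x) :
    ∀ t ∈ Icc 0 T, B (f t) (f t) = B (f 0) (f 0) + ∫ s in (0 : ℝ)..t, 2 * B (f s) (F s) := by
  intro t ht
  set g : ℝ → X := fun t => f 0 + ∫ s in (0 : ℝ)..t, F s with hg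
  have acg : AbsolutelyContinuousOnInterval g 0 T := by
    refine absolutelyContinuousOnInterval_of_dist_le (C := 1)
      (absolutelyContinuousOnInterval_primitive hF) fun s _ t _ => ?_
    simp [hg]
  obtain ⟨C, hC⟩ := acg.exists_bound
  have acq : AbsolutelyContinuousOnInterval (fun t => B (g t) (g t)) 0 T := by
    refine absolutelyContinuousOnInterval_of_dist_le (C := ‖B‖ * (2 * C)) acg fun s hs t ht => ?_
    rw [dist_eq_norm, dist_eq_norm]
    -- Symmetry factors the difference of squares, so the quadratic form is Lipschitz along the
    -- bounded curve `g`.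
    have e : B (g s) (g s) - B (g t) (g t) = B (g s + g t) (g s - g t) := by
      simp only [map_add, map_sub, _root_.add_apply]
      rw [hB (g t) (g s)]; ring
    rw [e]
    refine (B.le_opNorm₂ _ _).trans ?_
    gcongr
    exact (norm_add_le _ _).trans (by linarith [hC s hs, hC t ht])
  have hsubT : uIcc 0 t ⊆ uIcc 0 T := by
    rw [uIcc_of_le ht.1, uIcc_of_le hT.le]; exact Icc_subset_Icc_right ht.2
  have e1 := (acq.mono hsubT).integral_deriv_eq_sub
  have e2 : ∫ x in (0 : ℝ)..t, deriv (fun t => B (g t) (g t)) x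
      = ∫ s in (0 : ℝ)..t, 2 * B (f s) (F s) := by
    refine intervalIntegral.integral_congr_ae ?_
    filter_upwards [hF.ae_hasDerivAt_integral] with x h1 hx
    have hxT := hsubT (uIoc_subset_uIcc hx)
    have d1 : HasDerivAt g (F x) x := (h1 hxT 0 (by simp)).const_add _
    have d2 := (B.hasFDerivAt.comp_hasDerivAt x d1).clm_apply d1
    have d3 : deriv (fun t => B (g t) (g t)) x = _ := d2.deriv
    rw [uIcc_of_le hT.le] at hxT
    have hgx : f x = g x := hf x hxT
    rw [d3, hgx, hB (F x), Function.comp_apply]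
    ring
  have g0 : g 0 = f 0 := by simp [hg]
  rw [e2] at e1
  have hgt : g t = f t := (hf t ht).symm
  rw [g0, hgt] at e1
  linarith

/-! ### The energy identity in a Gelfand triple -/

section Gelfand

variable {W H : Type} [NormedAddCommGroup W] [InnerProductSpace ℝ W]
  [NormedAddCommGroup H] [InnerProductSpace ℝ H]

/-- `hR` is the weak form of `(ε + ι*ι) R = 1`; both sides are the value at `(R x, R y)` of the
symmetric form `ε⟨·,·⟩ + ⟨ι·, ι·⟩`. -/
theorem resolvent_symm {ι : W →L[ℝ] H} {ε : ℝ} {R : W →L[ℝ] W}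
    (hR : ∀ x y, ε * inner ℝ (R x) y + inner ℝ (ι (R x)) (ι y) = inner ℝ x y) (x y : W) :
    inner ℝ (R x) y = (inner ℝ (R y) x : ℝ) := by
  have h1 := hR y (R x)
  have h2 := hR x (R y)
  rw [real_inner_comm (R y) (R x), real_inner_comm (ι (R y)) (ι (R x))] at h2
  rw [real_inner_comm, ← h1, h2, real_inner_comm]

variable [CompleteSpace W]

/-- The resolvent `(ε + ι*ι)⁻¹` on `W`. -/
theorem exists_resolvent (ι : W →L[ℝ] H) {ε : ℝ} (hε : 0 < ε) :
    ∃ R : W →L[ℝ] W, ∀ x y, ε * inner ℝ (R x) y + inner ℝ (ι (R x)) (ι y) = inner ℝ x y := by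
  let Bf : W →L[ℝ] W →L[ℝ] ℝ :=
    ε • innerSL ℝ + ((innerSL ℝ).bilinearComp ι ι)
  have hBf : ∀ x y, Bf x y = ε * inner ℝ x y + inner ℝ (ι x) (ι y) := fun x y => by
    simp [Bf]; exact Or.inl rfl
  -- Lax–Milgram, with coercivity constant `ε`.
  have hco : IsCoercive Bf := by
    refine ⟨ε, hε, fun x => ?_⟩
    rw [hBf, real_inner_self_eq_norm_sq, real_inner_self_eq_norm_sq]
    nlinarith [sq_nonneg ‖ι x‖]
  refine ⟨(hco.continuousLinearEquivOfBilin.symm : W →L[ℝ] W), fun x y => ?_⟩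
  rw [← hBf]
  have := hco.continuousLinearEquivOfBilin_apply (hco.continuousLinearEquivOfBilin.symm x) y
  simpa using this.symm

variable [CompleteSpace H]

/-- Test the equation of `R ι* h` with itself and discard the `ε` term. The bound is uniform in `ε`.
-/
theorem resolvent_contraction {ι : W →L[ℝ] H} {ε : ℝ} (hε : 0 < ε) {R : W →L[ℝ] W}
    (hR : ∀ x y, ε * inner ℝ (R x) y + inner ℝ (ι (R x)) (ι y) = inner ℝ x y) (h : H) :
    ‖ι (R (ι.adjoint h))‖ ≤ ‖h‖ := by
  have h1 := hR (ι.adjoint h) (R (ι.adjoint h))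
  rw [ContinuousLinearMap.adjoint_inner_left, real_inner_self_eq_norm_sq,
    real_inner_self_eq_norm_sq] at h1
  have h2 := real_inner_le_norm h (ι (R (ι.adjoint h)))
  set a := ‖ι (R (ι.adjoint h))‖
  by_contra hcon
  have : 0 ≤ ε * ‖R (ι.adjoint h)‖ ^ 2 := by positivity
  nlinarith [norm_nonneg h, norm_nonneg (ι (R (ι.adjoint h)))]

/-- With `r = R ι* ι x`, testing with `r - x` gives `ε⟨r, r - x⟩ + ‖ι(r - x)‖² = 0`. Hence `⟨r, r -
x⟩ ≤ 0`, which is the first bound; Cauchy–Schwarz then gives the second. -/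
theorem resolvent_bounds {ι : W →L[ℝ] H} {ε : ℝ} (hε : 0 < ε) {R : W →L[ℝ] W}
    (hR : ∀ x y, ε * inner ℝ (R x) y + inner ℝ (ι (R x)) (ι y) = inner ℝ x y) (x : W) :
    ‖R (ι.adjoint (ι x))‖ ≤ ‖x‖ ∧ ‖ι (R (ι.adjoint (ι x)) - x)‖ ^ 2 ≤ 2 * ε * ‖x‖ ^ 2 := by
  set r := R (ι.adjoint (ι x)) with hr
  have h1 := hR (ι.adjoint (ι x)) (r - x)
  rw [ContinuousLinearMap.adjoint_inner_left, ← hr] at h1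
  have h2 : ε * inner ℝ r (r - x) + ‖ι (r - x)‖ ^ 2 = 0 := by
    rw [← real_inner_self_eq_norm_sq, map_sub ι r x, inner_sub_left (ι r) (ι x), ← map_sub]
    linarith
  have h3 : ‖r‖ ≤ ‖x‖ := by
    have h4 : ε * inner ℝ r (r - x) ≤ 0 := by nlinarith [sq_nonneg ‖ι (r - x)‖]
    have h5 : inner ℝ r (r - x) ≤ (0 : ℝ) := by
      by_contra hcon
      nlinarith
    rw [inner_sub_right, real_inner_self_eq_norm_sq] at h5
    have h6 := real_inner_le_norm r x
    by_contra hcon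
    nlinarith [norm_nonneg x, norm_nonneg r]
  refine ⟨h3, ?_⟩
  have h4 := neg_le_of_abs_le (abs_real_inner_le_norm r (r - x))
  have h5 : ‖r - x‖ ≤ 2 * ‖x‖ := (norm_sub_le _ _).trans (by linarith)
  have h6 : ‖r‖ * ‖r - x‖ ≤ ‖x‖ * (2 * ‖x‖) :=
    mul_le_mul h3 h5 (norm_nonneg _) (norm_nonneg _)
  nlinarith

theorem tendsto_resolvent_range {ι : W →L[ℝ] H} {ε : ℕ → ℝ} (hε : ∀ n, 0 < ε n)
    (hε0 : Tendsto ε atTop (𝓝 0)) {R : ℕ → W →L[ℝ] W}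
    (hR : ∀ n x y, ε n * inner ℝ (R n x) y + inner ℝ (ι (R n x)) (ι y) = inner ℝ x y) (x : W) :
    Tendsto (fun n => ι (R n (ι.adjoint (ι x)))) atTop (𝓝 (ι x)) := by
  rw [tendsto_iff_norm_sub_tendsto_zero]
  have h1 : Tendsto (fun n => ‖ι (R n (ι.adjoint (ι x))) - ι x‖ ^ 2) atTop (𝓝 0) := by
    refine squeeze_zero (fun n => sq_nonneg _) (fun n => ?_)
      (by simpa using (hε0.const_mul 2).mul_const (‖x‖ ^ 2))
    rw [← map_sub]
    exact (resolvent_bounds (hε n) (hR n) x).2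
  simpa [Real.sqrt_sq (norm_nonneg _)] using h1.sqrt

/-- Weak convergence in `W`: the sequence is bounded, and it converges against the vectors `ι* h`,
which are dense because `ι` is injective. This is enough, as the limit is taken under a fixed
functional `F s`. -/
theorem tendsto_resolvent {ι : W →L[ℝ] H} (hι : Function.Injective ι) {ε : ℕ → ℝ}
    (hε : ∀ n, 0 < ε n) (hε0 : Tendsto ε atTop (𝓝 0)) {R : ℕ → W →L[ℝ] W}
    (hR : ∀ n x y, ε n * inner ℝ (R n x) y + inner ℝ (ι (R n x)) (ι y) = inner ℝ x y) (x w : W) :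
    Tendsto (fun n => inner ℝ w (R n (ι.adjoint (ι x)))) atTop (𝓝 (inner ℝ w x : ℝ)) := by
  have hd : DenseRange ι.adjoint := by
    have h1 : (LinearMap.range ι.adjoint.toLinearMap)ᗮ = ⊥ := by
      rw [Submodule.eq_bot_iff]
      intro y hy
      refine hι ?_
      rw [map_zero, ← inner_self_eq_zero (𝕜 := ℝ), ← ContinuousLinearMap.adjoint_inner_left]
      exact (Submodule.mem_orthogonal _ _).1 hy _ (LinearMap.mem_range_self _ _)
    have h2 := (Submodule.topologicalClosure_eq_top_iff (K := LinearMap.range ι.adjoint.toLinearMap)).2 h1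
    exact (Submodule.dense_iff_topologicalClosure_eq_top).2 h2
  rw [Metric.tendsto_atTop]
  intro δ hδ
  obtain ⟨h, hh⟩ := hd.exists_dist_lt w (ε := δ / (4 * (‖x‖ + 1))) (by positivity)
  have h1 := (tendsto_const_nhds (x := h)).inner (𝕜 := ℝ) (tendsto_resolvent_range hε hε0 hR x)
  obtain ⟨N, hN⟩ := Metric.tendsto_atTop.1 h1 (δ / 2) (by positivity)
  refine ⟨N, fun n hn => ?_⟩
  have h2 := hN n hn
  rw [Real.dist_eq, ← inner_sub_right] at h2 ⊢
  rw [← map_sub, ← ContinuousLinearMap.adjoint_inner_left] at h2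
  have h3 : (inner ℝ w (R n (ι.adjoint (ι x)) - x) : ℝ) =
      inner ℝ (w - ι.adjoint h) (R n (ι.adjoint (ι x)) - x) +
      inner ℝ (ι.adjoint h) (R n (ι.adjoint (ι x)) - x) := by
    rw [← inner_add_left, sub_add_cancel]
  have h4 : ‖R n (ι.adjoint (ι x)) - x‖ ≤ 2 * ‖x‖ :=
    (norm_sub_le _ _).trans (by linarith [(resolvent_bounds (hε n) (hR n) x).1])
  have h5 := (abs_real_inner_le_norm (w - ι.adjoint h) (R n (ι.adjoint (ι x)) - x)).trans
    (mul_le_mul_of_nonneg_left h4 (norm_nonneg _))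
  rw [dist_eq_norm] at hh
  have h6 : ‖w - ι.adjoint h‖ * (2 * ‖x‖) ≤ δ / 2 := by
    have h7 : ‖w - ι.adjoint h‖ * (2 * ‖x‖) ≤ δ / (4 * (‖x‖ + 1)) * (2 * (‖x‖ + 1)) :=
      mul_le_mul hh.le (by linarith) (by positivity) (by positivity)
    refine h7.trans_eq ?_
    field_simp
    norm_num
  rw [h3]
  refine (abs_add_le _ _).trans_lt ?_
  linarith

theorem tendsto_resolvent_closure {ι : W →L[ℝ] H} {ε : ℕ → ℝ} (hε : ∀ n, 0 < ε n)
    (hε0 : Tendsto ε atTop (𝓝 0)) {R : ℕ → W →L[ℝ] W}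
    (hR : ∀ n x y, ε n * inner ℝ (R n x) y + inner ℝ (ι (R n x)) (ι y) = inner ℝ x y) {h : H}
    (hh : h ∈ closure (range ι)) :
    Tendsto (fun n => ι (R n (ι.adjoint h))) atTop (𝓝 h) := by
  rw [Metric.tendsto_atTop]
  intro δ hδ
  obtain ⟨_, ⟨x, rfl⟩, hx⟩ := Metric.mem_closure_iff.1 hh (δ / 3) (by positivity)
  obtain ⟨N, hN⟩ := Metric.tendsto_atTop.1 (tendsto_resolvent_range hε hε0 hR x) (δ / 3)
    (by positivity)
  refine ⟨N, fun n hn => ?_⟩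
  have h1 := hN n hn
  have h2 : dist (ι (R n (ι.adjoint h))) (ι (R n (ι.adjoint (ι x)))) ≤ dist h (ι x) := by
    rw [dist_eq_norm, dist_eq_norm, ← map_sub, ← map_sub, ← map_sub]
    exact resolvent_contraction (hε n) (hR n) _
  have h3 := dist_triangle4 (ι (R n (ι.adjoint h))) (ι (R n (ι.adjoint (ι x)))) (ι x) h
  rw [dist_comm (ι x) h] at h3
  linarith

/-- **The Lions–Magenes energy identity**: `‖f(t)‖² = ‖f(0)‖² + 2 ∫₀ᵗ ⟨f', f⟩` when `f` takes its
values in `W` and its derivative takes its values in the dual of `W`, in the square mean. -/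
theorem norm_sq_eq_add_integral_dual {ι : W →L[ℝ] H} (hι : Function.Injective ι) {T : ℝ}
    (hT : 0 < T) {f : ℝ → H} (hf : ContinuousOn f (Icc 0 T)) {U : ℝ → W}
    (hU : MemLp U 2 (volume.restrict (Ioo 0 T)))
    (hUf : ∀ᵐ t ∂volume.restrict (Ioo 0 T), ι (U t) = f t) {F : ℝ → W →L[ℝ] ℝ}
    (hF : MemLp F 2 (volume.restrict (Ioo 0 T)))
    (hfF : ∀ t ∈ Icc 0 T, (innerSL ℝ (f t)).comp ι = (innerSL ℝ (f 0)).comp ι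
      + ∫ s in (0 : ℝ)..t, F s) :
    IntegrableOn (fun s => F s (U s)) (Ioo 0 T) ∧
    ∀ t ∈ Icc 0 T, ‖f t‖ ^ 2 = ‖f 0‖ ^ 2 + ∫ s in (0 : ℝ)..t, 2 * F s (U s) := by
  have hbound : Integrable (fun s => ‖F s‖ * ‖U s‖) (volume.restrict (Ioo 0 T)) :=
    MemLp.integrable_mul hF.norm hU.norm
  have hFI : IntervalIntegrable F volume 0 T := by
    rw [intervalIntegrable_iff_integrableOn_Ioo_of_le hT.le]
    exact hF.integrable (by norm_num)
  refine ⟨hbound.mono' ((ContinuousLinearMap.id ℝ (W →L[ℝ] ℝ)).aestronglyMeasurable_comp₂ hF.1 hU.1)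
    (Eventually.of_forall fun s => (F s).le_opNorm _), fun t ht => ?_⟩
  -- Membership in the range of `ι` is known for almost every time only; continuity of `f` upgrades
  -- it to the closure at every time, including the endpoints.
  have hcl : ∀ t ∈ Icc 0 T, f t ∈ closure (range ι) := by
    have hne : (closure (range ι)).Nonempty := (range_nonempty ι).closure
    have hc : ContinuousOn (fun t => Metric.infDist (f t) (closure (range ι))) (Icc 0 T) :=
      (Metric.continuous_infDist_pt _).comp_continuousOn hf
    have h1 : EqOn (fun t => Metric.infDist (f t) (closure (range ι))) (fun _ => 0) (Ioo 0 T) := by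
      refine Measure.eqOn_open_of_ae_eq (μ := volume) ?_ isOpen_Ioo
        (hc.mono Ioo_subset_Icc_self) continuousOn_const
      filter_upwards [hUf] with t ht
      rw [← ht]
      exact Metric.infDist_zero_of_mem (subset_closure (mem_range_self _))
    have h2 := h1.of_subset_closure hc continuousOn_const Ioo_subset_Icc_self
      (by rw [closure_Ioo hT.ne])
    intro t ht
    exact (isClosed_closure.mem_iff_infDist_zero hne).2 (h2 ht)
  let ε : ℕ → ℝ := fun n => 1 / ((n : ℝ) + 1)
  have hε : ∀ n, 0 < ε n := fun n => by positivity
  have hε0 : Tendsto ε atTop (𝓝 0) := tendsto_one_div_add_atTop_nhds_zero_nat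
  choose R hR using fun n => exists_resolvent ι (hε n)
  let J : (W →L[ℝ] ℝ) →L[ℝ] W := LinearMap.mkContinuous
    { toFun := (InnerProductSpace.toDual ℝ W).symm
      map_add' := map_add _
      map_smul' := fun c x => by simp } 1 (fun x => by simp)
  have hJ : ∀ (G : W →L[ℝ] ℝ) (x : W), inner ℝ (J G) x = G x := fun G x =>
    InnerProductSpace.toDual_symm_apply
  have hJι : ∀ h : H, J ((innerSL ℝ h).comp ι) = ι.adjoint h := by
    intro h
    refine ext_inner_right ℝ fun x => ?_
    rw [hJ, ContinuousLinearMap.adjoint_inner_left]; rfl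
  -- The regularized energies are `⟨R ι* f, ι* f⟩ = ⟨ι R ι* f, f⟩`, which tend to `‖f‖²`. The curve
  -- `ι* f` is absolutely continuous in `W`, its derivative being the Riesz representative of `F`.
  let B : ℕ → W →L[ℝ] W →L[ℝ] ℝ := fun n => (innerSL ℝ).comp (R n)
  have hBdef : ∀ n x y, B n x y = inner ℝ (R n x) y := fun n x y => rfl
  have hz : ∀ t ∈ Icc 0 T, ι.adjoint (f t) = ι.adjoint (f 0) + ∫ s in (0 : ℝ)..t, J (F s) := by
    intro t ht
    have hFt : IntervalIntegrable F volume 0 t :=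
      hFI.mono_set (by rw [uIcc_of_le ht.1, uIcc_of_le hT.le]; exact Icc_subset_Icc_right ht.2)
    rw [J.intervalIntegral_comp_comm hFt, ← hJι, ← hJι, ← map_add, hfF t ht]
  have hJF : IntervalIntegrable (fun s => J (F s)) volume 0 T :=
    ⟨J.integrable_comp hFI.1, J.integrable_comp hFI.2⟩
  have hen := fun n => bilin_self_eq_add_integral hT hJF hz (B n)
    (fun x y => by rw [hBdef, hBdef]; exact resolvent_symm (hR n) x y) t ht
  have hlim : ∀ t ∈ Icc 0 T, Tendsto (fun n => B n (ι.adjoint (f t)) (ι.adjoint (f t))) atTop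
      (𝓝 (‖f t‖ ^ 2)) := by
    intro t ht
    rw [← real_inner_self_eq_norm_sq]
    simp_rw [hBdef, ContinuousLinearMap.adjoint_inner_right]
    exact (tendsto_resolvent_closure hε hε0 hR (hcl t ht)).inner tendsto_const_nhds
  have hsub : Ioo 0 t ⊆ Ioo 0 T := Ioo_subset_Ioo_right ht.2
  have hint : Tendsto (fun n => ∫ s in (0 : ℝ)..t, 2 * B n (ι.adjoint (f s)) (J (F s))) atTop
      (𝓝 (∫ s in (0 : ℝ)..t, 2 * F s (U s))) := by
    simp_rw [intervalIntegral.integral_of_le ht.1, integral_Ioc_eq_integral_Ioo]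
    have hfm : AEStronglyMeasurable f (volume.restrict (Ioo 0 t)) :=
      (hf.mono (hsub.trans Ioo_subset_Icc_self)).aestronglyMeasurable measurableSet_Ioo
    have hFm : AEStronglyMeasurable F (volume.restrict (Ioo 0 t)) :=
      hF.1.mono_measure (Measure.restrict_mono hsub le_rfl)
    refine tendsto_integral_of_dominated_convergence (fun s => 2 * (‖F s‖ * ‖U s‖))
      (fun n => ?_) ?_ (fun n => ?_) ?_
    · exact ((B n).aestronglyMeasurable_comp₂ (ι.adjoint.continuous.comp_aestronglyMeasurable hfm)
        (J.continuous.comp_aestronglyMeasurable hFm)).const_mul 2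
    · exact (IntegrableOn.mono_set hbound hsub).const_mul 2
    · filter_upwards [ae_restrict_of_ae_restrict_of_subset hsub hUf] with s hs
      rw [norm_mul, Real.norm_ofNat, hBdef, real_inner_comm, hJ, ← hs]
      have h1 := ((F s).le_opNorm (R n (ι.adjoint (ι (U s))))).trans
        (mul_le_mul_of_nonneg_left (resolvent_bounds (hε n) (hR n) (U s)).1 (norm_nonneg _))
      linarith
    · filter_upwards [ae_restrict_of_ae_restrict_of_subset hsub hUf] with s hs
      have h1 := (tendsto_resolvent hι hε hε0 hR (U s) (J (F s))).const_mul 2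
      rw [hs, hJ] at h1
      refine h1.congr fun n => ?_
      rw [hBdef, real_inner_comm]
  have h0 : (0 : ℝ) ∈ Icc 0 T := left_mem_Icc.2 hT.le
  refine tendsto_nhds_unique (hlim t ht) ?_
  exact ((hlim 0 h0).add hint).congr fun n => (hen n).symm

end Gelfand

end

/-! ### The energy inequality at a fixed time -/

/-- A divergence-free vector field with the regularity of `H³`. -/
structure RegularField (f : L2 Vec) : Prop where
  wd : ∀ i j, WD j (fun x => f x i) (fun x => wd j f x i)
  two : ∀ i j, WDer (Pi.single j 2) (fun x => f x i) (fun x => wderiv (Pi.single j 2) f x i)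
  bdd : ∃ C, ∀ i, ∀ᵐ x ∂torusMeasure, |f x i| ≤ C
  div : ∀ᵐ x ∂torusMeasure, ∑ j, CalmedMHD.wd j f x j = 0

/-- A scalar function which is bounded and belongs to `H¹`. -/
structure RegularScalar (f : L2 ℝ) : Prop where
  wd : ∀ j, WD j f (wd j f)
  bdd : ∃ C, ∀ᵐ x ∂torusMeasure, |f x| ≤ C

theorem regularField {k : ℕ} (hk : 2 ≤ k) (U : Sob k Vec) (hU : toL2 k Vec U ∈ spaceV) :
    RegularField (toL2 k Vec U) where
  wd i j := Sob.wd_wder (by omega) U (EuclideanSpace.proj i) j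
  two i j := Sob.wderiv_two_wder hk U (EuclideanSpace.proj i) j
  bdd := ⟨_, fun i => Sob.ae_abs_le hk U (EuclideanSpace.proj i) (abs_proj_le i)⟩
  div := ae_div_eq_zero (by omega) U (spaceV_le_spaceH hU)

theorem regularScalar {k : ℕ} (hk : 2 ≤ k) (U : Sob k ℝ) : RegularScalar (toL2 k ℝ U) where
  wd j := Sob.wd_wder (by omega) U (ContinuousLinearMap.id ℝ ℝ) j
  bdd := ⟨_, Sob.ae_abs_le hk U (ContinuousLinearMap.id ℝ ℝ) fun _ => le_rfl⟩

/-- Integrable functions of zero mean. -/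
def ZeroMean (f : T2 → ℝ) : Prop :=
  Integrable f torusMeasure ∧ ∫ x, f x ∂torusMeasure = 0

theorem ZeroMean.add {f g : T2 → ℝ} (hf : ZeroMean f) (hg : ZeroMean g) :
    ZeroMean fun x => f x + g x :=
  ⟨hf.1.add hg.1, by rw [integral_add hf.1 hg.1, hf.2, hg.2, add_zero]⟩

theorem ZeroMean.const_mul {f : T2 → ℝ} (hf : ZeroMean f) (a : ℝ) : ZeroMean fun x => a * f x :=
  ⟨hf.1.const_mul a, by rw [integral_const_mul, hf.2, mul_zero]⟩

theorem ZeroMean.sum {f : Fin 2 → T2 → ℝ} (hf : ∀ i, ZeroMean (f i)) :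
    ZeroMean fun x => ∑ i, f i x :=
  ⟨integrable_finsetSum _ fun i _ => (hf i).1, by
    rw [integral_finsetSum _ fun i _ => (hf i).1]; simp [(hf _).2]⟩

theorem ae_bdd_sub {f g : T2 → ℝ} {C D : ℝ} (hf : ∀ᵐ x ∂torusMeasure, |f x| ≤ C)
    (hg : ∀ᵐ x ∂torusMeasure, |g x| ≤ D) : ∀ᵐ x ∂torusMeasure, |f x - g x| ≤ C + D := by
  filter_upwards [hf, hg] with x h1 h2
  exact (abs_sub _ _).trans (add_le_add h1 h2)

theorem RegularField.zeroMean_transport {v : L2 Vec} (hv : RegularField v) {f g : T2 → ℝ}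
    {f' g' : Fin 2 → T2 → ℝ} (hf : ∀ j, WD j f (f' j)) (hg : ∀ j, WD j g (g' j)) {C D : ℝ}
    (hC : ∀ᵐ x ∂torusMeasure, |f x| ≤ C) (hD : ∀ᵐ x ∂torusMeasure, |g x| ≤ D) :
    ZeroMean fun x => ∑ j, (v x j * f' j x * g x + v x j * g' j x * f x) := by
  obtain ⟨B, hB⟩ := hv.bdd
  exact integral_transport (fun j => hv.wd j j) hv.div hf hg hB hC hD

theorem lap_apply (f : L2 Vec) (i : Fin 2) :
    ∀ᵐ x ∂torusMeasure, lap f x i = ∑ j, wderiv (Pi.single j 2) f x i := by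
  unfold lap
  rw [Fin.sum_univ_two]
  filter_upwards [Lp.coeFn_add (wderiv (Pi.single 0 2) f) (wderiv (Pi.single 1 2) f)] with x hx
  rw [hx, Fin.sum_univ_two]; rfl

/-- The identity `-∫ Δw · w = ∫ |∇w|²` for one component of `w = u - v`, put as a zero mean so that
it can be added to an integrand. -/
theorem RegularField.zeroMean_lap {u v : L2 Vec} (hu : RegularField u) (hv : RegularField v)
    (i : Fin 2) : ZeroMean fun x => (lap u x i - lap v x i) * (u x i - v x i)
      + ∑ j, (CalmedMHD.wd j u x i - CalmedMHD.wd j v x i) ^ 2 := by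
  have hw := fun j => (hu.wd i j).sub (hv.wd i j)
  have h2 := fun j => WD.of_two (hw j) ((hu.two i j).sub (hv.two i j))
  have key : ZeroMean fun x => ∑ j, ((wderiv (Pi.single j 2) u x i - wderiv (Pi.single j 2) v x i)
      * (u x i - v x i) + (CalmedMHD.wd j u x i - CalmedMHD.wd j v x i) *
        (CalmedMHD.wd j u x i - CalmedMHD.wd j v x i)) := by
    refine ZeroMean.sum fun j => ?_
    have i1 := integrable_mul (h2 j).right (hw j).left
    have i2 := integrable_mul (hw j).right (hw j).right
    refine ⟨i1.add i2, ?_⟩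
    rw [integral_add i1 i2, (h2 j).ibp (hw j), neg_add_cancel]
  have hae : (fun x => ∑ j, ((wderiv (Pi.single j 2) u x i - wderiv (Pi.single j 2) v x i)
      * (u x i - v x i) + (CalmedMHD.wd j u x i - CalmedMHD.wd j v x i) *
        (CalmedMHD.wd j u x i - CalmedMHD.wd j v x i))) =ᵐ[torusMeasure]
      fun x => (lap u x i - lap v x i) * (u x i - v x i)
        + ∑ j, (CalmedMHD.wd j u x i - CalmedMHD.wd j v x i) ^ 2 := by
    filter_upwards [lap_apply u i, lap_apply v i] with x h1 h2
    rw [h1, h2]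
    simp only [Fin.sum_univ_two]
    ring
  exact ⟨key.1.congr hae, (integral_congr_ae hae).symm.trans key.2⟩

/-! ### Pointwise bounds and the energy inequality -/

/-- The Lipschitz bound for the calmed source. -/
theorem calm_sub_le {ζ : ℝ → ℝ} {L : ℝ≥0} (hL : LipschitzWith L ζ) {M : ℝ} (hM : ∀ r, |ζ r| ≤ M)
    {p q : ℝ} (hp : 0 ≤ p) : |ζ p * p - ζ q * q| ≤ (L * p + M) * |p - q| := by
  have h1 : |ζ p - ζ q| ≤ L * |p - q| := by
    have := hL.dist_le_mul p q
    rwa [Real.dist_eq, Real.dist_eq] at this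
  -- In this splitting the unbounded factor is `p`, the curl of the first solution; the second one
  -- enters only through the bounded `ζ q`.
  have h2 : ζ p * p - ζ q * q = (ζ p - ζ q) * p + ζ q * (p - q) := by ring
  rw [h2]
  refine (abs_add_le _ _).trans ?_
  rw [abs_mul, abs_mul, abs_of_nonneg hp]
  nlinarith [hM q, abs_nonneg (p - q)]

theorem abs_mul_mul_le {S x D y Y : ℝ} (hD : |D| ≤ S) (h : x ^ 2 + y ^ 2 ≤ 2 * Y) :
    |x * D * y| ≤ S * Y := by
  rw [abs_mul, abs_mul]
  have h1 : |x| * |y| ≤ Y := by nlinarith [sq_nonneg (|x| - |y|), sq_abs x, sq_abs y]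
  have h2 : 0 ≤ |x| * |y| := by positivity
  calc |x| * |D| * |y| = |D| * (|x| * |y|) := by ring
    _ ≤ S * Y := mul_le_mul hD h1 h2 ((abs_nonneg D).trans hD)

/-- The growth rate in the energy inequality, in terms of a bound `S` of the gradients. -/
def rate (μ g α : ℝ) (L : ℝ≥0) (M S : ℝ) : ℝ :=
  18 * S + g + (|α * μ| * (2 * L * S + M)) ^ 2 / (2 * μ)

/-- What survives the cancellations. Each of the sixteen terms of the four velocity-magnetic sums
and of the two temperature transport terms is at most `S Y`, which is the 18 in `rate`. -/
theorem pointwise_bound {μ g α : ℝ} (hμ : 0 < μ) (hg : 0 < g) {L : ℝ≥0} {M S : ℝ} (hM : 0 ≤ M)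
    {w d : Fin 2 → ℝ} {φ : ℝ} {Du Db Dd : Fin 2 → Fin 2 → ℝ} {Dθ : Fin 2 → ℝ}
    (hDu : ∀ i j, |Du i j| ≤ S) (hDb : ∀ i j, |Db i j| ≤ S) (hDθ : ∀ j, |Dθ j| ≤ S)
    {N : ℝ} (hN : |N| ≤ (L * (2 * S) + M) * (|Dd 1 0| + |Dd 0 1|)) :
    - ∑ i, ∑ j, w j * Du i j * w i + ∑ i, ∑ j, d j * Db i j * w i
      - ∑ i, ∑ j, w j * Db i j * d i + ∑ i, ∑ j, d j * Du i j * d i + g * φ * w 1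
      - ∑ j, w j * Dθ j * φ + α * μ * N * φ - μ * ∑ i, ∑ j, Dd i j ^ 2
    ≤ rate μ g α L M S * (∑ i, w i ^ 2 + ∑ i, d i ^ 2 + φ ^ 2) := by
  set Y := ∑ i, w i ^ 2 + ∑ i, d i ^ 2 + φ ^ 2 with hY
  simp only [Fin.sum_univ_two] at hY
  have hS : 0 ≤ S := (abs_nonneg _).trans (hDu 0 0)
  have hw : ∀ i, w i ^ 2 ≤ Y := by
    rw [hY, Fin.forall_fin_two]
    constructor <;> nlinarith [sq_nonneg (w 0), sq_nonneg (w 1), sq_nonneg (d 0), sq_nonneg (d 1),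
      sq_nonneg φ]
  have hd : ∀ i, d i ^ 2 ≤ Y := by
    rw [hY, Fin.forall_fin_two]
    constructor <;> nlinarith [sq_nonneg (w 0), sq_nonneg (w 1), sq_nonneg (d 0), sq_nonneg (d 1),
      sq_nonneg φ]
  have hφ : φ ^ 2 ≤ Y := by
    nlinarith [sq_nonneg (w 0), sq_nonneg (w 1), sq_nonneg (d 0), sq_nonneg (d 1)]
  have e1 := fun i j => abs_le.1 (abs_mul_mul_le (x := w j) (y := w i) (hDu i j)
    (by linarith [hw i, hw j]) : |w j * Du i j * w i| ≤ S * Y)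
  have e2 := fun i j => abs_le.1 (abs_mul_mul_le (x := d j) (y := w i) (hDb i j)
    (by linarith [hw i, hd j]) : |d j * Db i j * w i| ≤ S * Y)
  have e3 := fun i j => abs_le.1 (abs_mul_mul_le (x := w j) (y := d i) (hDb i j)
    (by linarith [hd i, hw j]) : |w j * Db i j * d i| ≤ S * Y)
  have e4 := fun i j => abs_le.1 (abs_mul_mul_le (x := d j) (y := d i) (hDu i j)
    (by linarith [hd i, hd j]) : |d j * Du i j * d i| ≤ S * Y)
  have e5 := fun j => abs_le.1 (abs_mul_mul_le (x := w j) (y := φ) (hDθ j)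
    (by linarith [hw j, hφ]) : |w j * Dθ j * φ| ≤ S * Y)
  have e6 : g * φ * w 1 ≤ g * Y := by
    rw [mul_assoc]
    refine mul_le_mul_of_nonneg_left ?_ hg.le
    nlinarith [sq_nonneg (φ - w 1), hw 1]
  set K := |α * μ| * (2 * L * S + M) with hK
  have hK0 : 0 ≤ K := by positivity
  have e7 : α * μ * N * φ ≤ K * (|Dd 1 0| + |Dd 0 1|) * |φ| := by
    refine (le_abs_self _).trans ?_
    rw [abs_mul, abs_mul, hK]
    refine mul_le_mul_of_nonneg_right ?_ (abs_nonneg _)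
    rw [mul_assoc]
    refine mul_le_mul_of_nonneg_left (hN.trans_eq ?_) (abs_nonneg _)
    ring
  -- Young's inequality. The curl involves the two off-diagonal entries of `∇d`, each absorbed by
  -- its own diffusion term; two costs `K²/(4μ)` add up to the `K²/(2μ)` of `rate`.
  have e8 : ∀ a : ℝ, K * |a| * |φ| ≤ μ * a ^ 2 + K ^ 2 / (4 * μ) * φ ^ 2 := by
    intro a
    have h1 : 0 ≤ (2 * μ * |a| - K * |φ|) ^ 2 / (4 * μ) := by positivity
    have h2 : (2 * μ * |a| - K * |φ|) ^ 2 / (4 * μ)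
        = μ * |a| ^ 2 + K ^ 2 / (4 * μ) * |φ| ^ 2 - K * |a| * |φ| := by
      field_simp; ring
    rw [sq_abs, sq_abs] at h2
    linarith
  have e9 : K ^ 2 / (2 * μ) * φ ^ 2 ≤ K ^ 2 / (2 * μ) * Y :=
    mul_le_mul_of_nonneg_left hφ (by positivity)
  have e10 : K ^ 2 / (2 * μ) * φ ^ 2 = 2 * (K ^ 2 / (4 * μ) * φ ^ 2) := by field_simp; ring
  have e11 : 0 ≤ μ * Dd 0 0 ^ 2 := by positivity
  have e12 : 0 ≤ μ * Dd 1 1 ^ 2 := by positivity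
  have e13 : rate μ g α L M S * Y = 18 * (S * Y) + g * Y + K ^ 2 / (2 * μ) * Y := by
    rw [rate, ← hK]; ring
  rw [e13]
  simp only [Fin.sum_univ_two]
  linarith [(e1 0 0).1, (e1 0 1).1, (e1 1 0).1, (e1 1 1).1, (e2 0 0).2, (e2 0 1).2, (e2 1 0).2,
    (e2 1 1).2, (e3 0 0).1, (e3 0 1).1, (e3 1 0).1, (e3 1 1).1, (e4 0 0).2, (e4 0 1).2,
    (e4 1 0).2, (e4 1 1).2, (e5 0).1, (e5 1).1, e8 (Dd 1 0), e8 (Dd 0 1)]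

/-- The integrand of the weak form of the temperature equation, tested with `φ`. -/
def heatDensity (μ κ α : ℝ) (ζ : ℝ → ℝ) (u b : L2 Vec) (θ φ : L2 ℝ) (x : T2) : ℝ :=
  -κ * ∑ j, wd j θ x * wd j φ x - adv u θ x * φ x
    + α * μ * (ζ (absCurl b x) * absCurl b x * φ x)

theorem integral_heatDensity (μ κ α : ℝ) {ζ : ℝ → ℝ} (hζ : Continuous ζ) {M : ℝ}
    (hM : ∀ r, |ζ r| ≤ M) {u b : L2 Vec} {θ φ : L2 ℝ} (hu : RegularField u) (hb : RegularField b)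
    (hθ : RegularScalar θ) (hφ : RegularScalar φ) :
    Integrable (heatDensity μ κ α ζ u b θ φ) torusMeasure ∧
    ∫ x, heatDensity μ κ α ζ u b θ φ x ∂torusMeasure =
      -κ * ∫ x, ∑ j, wd j θ x * wd j φ x ∂torusMeasure
        - ∫ x, adv u θ x * φ x ∂torusMeasure
        + α * μ * ∫ x, ζ (absCurl b x) * absCurl b x * φ x ∂torusMeasure := by
  obtain ⟨C, hC⟩ := hu.bdd
  have i1 : Integrable (fun x => ∑ j, wd j θ x * wd j φ x) torusMeasure :=
    integrable_finsetSum _ fun j _ => integrable_mul (hθ.wd j).right (hφ.wd j).right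
  have i2 : Integrable (fun x => adv u θ x * φ x) torusMeasure := by
    refine integrable_mul ?_ (hφ.wd 0).left
    exact memLp_finsetSum _ fun j _ => memLp_bdd_mul (hu.wd j j).left (hC j) (hθ.wd j).right
  have i3 : Integrable (fun x => ζ (absCurl b x) * absCurl b x * φ x) torusMeasure := by
    have hc : MemLp (absCurl b) 2 torusMeasure := ((hb.wd 1 0).right.sub (hb.wd 0 1).right).abs
    have hζc : AEStronglyMeasurable (fun x => ζ (absCurl b x)) torusMeasure :=
      hζ.comp_aestronglyMeasurable hc.1
    refine integrable_mul (memLp_bdd_mul (C := M) ?_ (Filter.Eventually.of_forall fun x => hM _) hc)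
      (hφ.wd 0).left
    exact MemLp.of_bound hζc M (Filter.Eventually.of_forall fun x => hM _)
  have i4 : Integrable (fun x => -κ * ∑ j, wd j θ x * wd j φ x - adv u θ x * φ x) torusMeasure :=
    (i1.const_mul (-κ)).sub i2
  refine ⟨i4.add (i3.const_mul (α * μ)), ?_⟩
  unfold heatDensity
  rw [integral_add i4 (i3.const_mul (α * μ)),
    integral_sub (i1.const_mul (-κ)) i2, integral_const_mul, integral_const_mul]

/-- All integrations by parts are gathered in one zero-mean correction `z`, so that the integral
inequality reduces to a pointwise one. -/
theorem ZeroMean.integral_le {E Y z : T2 → ℝ} (hz : ZeroMean z) (hE : Integrable E torusMeasure)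
    (hY : Integrable Y torusMeasure) {A : ℝ}
    (h : ∀ᵐ x ∂torusMeasure, E x - z x ≤ A * Y x) :
    ∫ x, E x ∂torusMeasure ≤ A * ∫ x, Y x ∂torusMeasure := by
  have h1 := integral_mono_ae (hE.sub hz.1) (hY.const_mul A) h
  rw [integral_const_mul] at h1
  have h2 : ∫ x, (E - z) x ∂torusMeasure = ∫ x, E x ∂torusMeasure := by
    rw [integral_sub' hE hz.1, hz.2, sub_zero]
  linarith

/-- The energy inequality for the difference of two solutions at a fixed time. -/
theorem energy_inequality {ν μ κ g α : ℝ} (hν : 0 < ν) (hμ : 0 < μ) (hκ : 0 < κ) (hg : 0 < g)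
    {ζ : ℝ → ℝ} {L : ℝ≥0} (hL : LipschitzWith L ζ) {M : ℝ} (hM : ∀ r, |ζ r| ≤ M)
    {u b v c : L2 Vec} {θ η φ : L2 ℝ} (hu : RegularField u) (hb : RegularField b)
    (hv : RegularField v) (hc : RegularField c) (hθ : RegularScalar θ) (hη : RegularScalar η)
    (hφ : RegularScalar φ) (hφe : φ = θ - η) {S : ℝ}
    (hSu : ∀ i j, ∀ᵐ x ∂torusMeasure, |wd j u x i| ≤ S)
    (hSb : ∀ i j, ∀ᵐ x ∂torusMeasure, |wd j b x i| ≤ S)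
    (hSθ : ∀ j, ∀ᵐ x ∂torusMeasure, |wd j θ x| ≤ S)
    {R₁ R₁' R₂ R₂' : L2 Vec}
    (hR₁ : R₁ =ᵐ[torusMeasure] fun x => ν • lap u x - adv u u x + adv b b x
      + (g * θ x) • EuclideanSpace.single (1 : Fin 2) (1 : ℝ))
    (hR₁' : R₁' =ᵐ[torusMeasure] fun x => ν • lap v x - adv v v x + adv c c x
      + (g * η x) • EuclideanSpace.single (1 : Fin 2) (1 : ℝ))
    (hR₂ : R₂ =ᵐ[torusMeasure] fun x => μ • lap b x - adv u b x + adv b u x)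
    (hR₂' : R₂' =ᵐ[torusMeasure] fun x => μ • lap c x - adv v c x + adv c v x) :
    inner ℝ (R₁ - R₁') (u - v) + inner ℝ (R₂ - R₂') (b - c)
      + (∫ x, heatDensity μ κ α ζ u b θ φ x ∂torusMeasure
        - ∫ x, heatDensity μ κ α ζ v c η φ x ∂torusMeasure)
      ≤ rate μ g α L M S * (‖u - v‖ ^ 2 + ‖b - c‖ ^ 2 + ‖φ‖ ^ 2) := by
  obtain ⟨Cu, hCu⟩ := hu.bdd
  obtain ⟨Cb, hCb⟩ := hb.bdd
  obtain ⟨Cv, hCv⟩ := hv.bdd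
  obtain ⟨Cc, hCc⟩ := hc.bdd
  obtain ⟨Cθ, hCθ⟩ := hθ.bdd
  obtain ⟨Cη, hCη⟩ := hη.bdd
  have hM0 : 0 ≤ M := (abs_nonneg _).trans (hM 0)
  have dw := fun i j => (hu.wd i j).sub (hv.wd i j)
  have dd := fun i j => (hb.wd i j).sub (hc.wd i j)
  have dφ := fun j => (hθ.wd j).sub (hη.wd j)
  have bw := fun i => ae_bdd_sub (hCu i) (hCv i)
  have bd := fun i => ae_bdd_sub (hCb i) (hCc i)
  have bφ := ae_bdd_sub hCθ hCη
  have hφx : φ =ᵐ[torusMeasure] fun x => θ x - η x := by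
    rw [hφe]; exact Lp.coeFn_sub θ η
  have hφd : ∀ j, wd j φ =ᵐ[torusMeasure] fun x => wd j θ x - wd j η x := fun j =>
    ((hφ.wd j).congr hφx (Filter.EventuallyEq.refl _ _)).unique (dφ j)
  have z1 := (ZeroMean.sum fun i => hu.zeroMean_lap hv i).const_mul ν
  have z2 := (ZeroMean.sum fun i => hb.zeroMean_lap hc i).const_mul μ
  -- With equal arguments the transport integrand is `2 (v·∇f) f`; the factor `-1/2` matches the
  -- term of the equation. `z6` pairs `d` with `w` and cancels the two magnetic cross terms at once.
  have z3 := (ZeroMean.sum fun i =>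
    hv.zeroMean_transport (dw i) (dw i) (bw i) (bw i)).const_mul (-(1 / 2))
  have z4 := (ZeroMean.sum fun i =>
    hv.zeroMean_transport (dd i) (dd i) (bd i) (bd i)).const_mul (-(1 / 2))
  have z5 := (hv.zeroMean_transport dφ dφ bφ bφ).const_mul (-(1 / 2))
  have z6 := ZeroMean.sum fun i => hc.zeroMean_transport (dd i) (dw i) (bd i) (bw i)
  have z := ((((z1.add z2).add z3).add z4).add z5).add z6
  obtain ⟨i1, e1⟩ := integral_heatDensity μ κ α hL.continuous hM hu hb hθ hφ
  obtain ⟨i2, e2⟩ := integral_heatDensity μ κ α hL.continuous hM hv hc hη hφ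
  have j1 := L2.integrable_inner (𝕜 := ℝ) (R₁ - R₁') (u - v)
  have j2 := L2.integrable_inner (𝕜 := ℝ) (R₂ - R₂') (b - c)
  have k1 := L2.integrable_inner (𝕜 := ℝ) (u - v) (u - v)
  have k2 := L2.integrable_inner (𝕜 := ℝ) (b - c) (b - c)
  have k3 := L2.integrable_inner (𝕜 := ℝ) φ φ
  have j3 : Integrable (fun x => inner ℝ ((R₁ - R₁') x) ((u - v) x)
      + inner ℝ ((R₂ - R₂') x) ((b - c) x)) torusMeasure := j1.add j2
  have i3 : Integrable (fun x => heatDensity μ κ α ζ u b θ φ x - heatDensity μ κ α ζ v c η φ x)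
      torusMeasure := i1.sub i2
  have k4 : Integrable (fun x => inner ℝ ((u - v) x) ((u - v) x)
      + inner ℝ ((b - c) x) ((b - c) x)) torusMeasure := k1.add k2
  rw [← real_inner_self_eq_norm_sq, ← real_inner_self_eq_norm_sq, ← real_inner_self_eq_norm_sq,
    L2.inner_def, L2.inner_def, L2.inner_def, L2.inner_def, L2.inner_def,
    ← integral_sub i1 i2, ← integral_add j1 j2, ← integral_add j3 i3,
    ← integral_add k1 k2, ← integral_add k4 k3]
  refine z.integral_le (j3.add i3) (k4.add k3) ?_
  filter_upwards [hR₁, hR₁', hR₂, hR₂', Lp.coeFn_sub R₁ R₁', Lp.coeFn_sub R₂ R₂',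
    Lp.coeFn_sub u v, Lp.coeFn_sub b c, hφx, hφd 0, hφd 1,
    ae_all_iff.2 fun i => ae_all_iff.2 (hSu i), ae_all_iff.2 fun i => ae_all_iff.2 (hSb i),
    ae_all_iff.2 hSθ] with x h1 h2 h3 h4 h5 h6 h7 h8 h9 h10 h11 su sb sθ
  have hcurl : |absCurl b x - absCurl c x| ≤
      |wd 0 b x 1 - wd 0 c x 1| + |wd 1 b x 0 - wd 1 c x 0| := by
    unfold absCurl
    refine (abs_abs_sub_abs_le _ _).trans ?_
    rw [show wd 0 b x 1 - wd 1 b x 0 - (wd 0 c x 1 - wd 1 c x 0)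
      = (wd 0 b x 1 - wd 0 c x 1) - (wd 1 b x 0 - wd 1 c x 0) by ring]
    exact abs_sub _ _
  have hcb : absCurl b x ≤ 2 * S := by
    unfold absCurl
    refine (abs_sub _ _).trans ?_
    linarith [sb 1 0, sb 0 1]
  have hN : |ζ (absCurl b x) * absCurl b x - ζ (absCurl c x) * absCurl c x| ≤
      (L * (2 * S) + M) * (|wd 0 b x 1 - wd 0 c x 1| + |wd 1 b x 0 - wd 1 c x 0|) := by
    refine (calm_sub_le hL hM (p := absCurl b x) (q := absCurl c x) (abs_nonneg _)).trans ?_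
    refine mul_le_mul ?_ hcurl (abs_nonneg _) ?_
    · exact add_le_add (mul_le_mul_of_nonneg_left hcb L.coe_nonneg) le_rfl
    · have hS : 0 ≤ S := (abs_nonneg _).trans (su 0 0)
      positivity
  have key := pointwise_bound (μ := μ) (g := g) (α := α) hμ hg (L := L) hM0
    (w := fun i => u x i - v x i) (d := fun i => b x i - c x i) (φ := θ x - η x)
    (Du := fun i j => wd j u x i) (Db := fun i j => wd j b x i)
    (Dd := fun i j => wd j b x i - wd j c x i) (Dθ := fun j => wd j θ x) su sb sθ hN
  have p1 : 0 ≤ ν * ((wd 0 u x 0 - wd 0 v x 0) ^ 2 + (wd 1 u x 0 - wd 1 v x 0) ^ 2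
    + ((wd 0 u x 1 - wd 0 v x 1) ^ 2 + (wd 1 u x 1 - wd 1 v x 1) ^ 2)) := by positivity
  have p2 : 0 ≤ κ * ((wd 0 θ x - wd 0 η x) ^ 2 + (wd 1 θ x - wd 1 η x) ^ 2) := by positivity
  simp only [Fin.sum_univ_two] at key
  simp only [Pi.add_apply, Pi.sub_apply, h5, h6, h7, h8, h1, h2, h3, h4, heatDensity, h9,
    Fin.sum_univ_two, h10, h11, PiLp.inner_apply, adv, PiLp.add_apply, PiLp.sub_apply,
    PiLp.smul_apply, smul_eq_mul, RCLike.inner_apply, conj_trivial, PiLp.single_apply]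
  simp only [if_true, zero_ne_one, if_false, mul_zero, mul_one, add_zero]
  -- The viscous and thermal dissipations `p1`, `p2` are discarded; the magnetic one was used up in
  -- `key`.
  refine le_trans (le_of_eq ?_) ((sub_le_self _ (add_nonneg p1 p2)).trans (key.trans (le_of_eq ?_)))
  · ring
  · ring

section

open Filter Topology

/-! ### Consequences of the definition of strong solutions -/

/-- The other components of an element of `H¹` are weak derivatives of the first, hence unique. The
Lions–Magenes identity needs this injectivity. -/
theorem toL2_one_injective : Function.Injective (toL2 1 ℝ) := by
  intro U V h
  refine Subtype.ext (PiLp.ext fun α => ?_)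
  have hU := (Sob.isWeakDeriv U α.2).wder (ContinuousLinearMap.id ℝ ℝ)
  have hV := (Sob.isWeakDeriv V α.2).wder (ContinuousLinearMap.id ℝ ℝ)
  rw [← h] at hV
  exact Lp.ext (hU.unique hV)

theorem InC.continuousOn {E : Type} [NormedAddCommGroup E] [NormedSpace ℝ E] {T : ℝ} {k : ℕ}
    {f : ℝ → L2 E} (h : InC T k f) : ContinuousOn f (Icc 0 T) := by
  obtain ⟨U, hU, hUf⟩ := h
  exact ((toL2 k E).continuous.comp_continuousOn hU).congr fun t ht => (hUf t ht).symm

/-- The projector is self-adjoint and fixes `w`, so it disappears when tested with a field of `H`;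
this is why the pressure plays no part. -/
theorem inner_leray_sub {w R R' : L2 Vec} (hw : w ∈ spaceH) :
    inner ℝ w (leray R - leray R') = (inner ℝ (R - R') w : ℝ) := by
  have h1 : leray w = w := Submodule.starProjection_eq_self_iff.2 hw
  rw [← map_sub, real_inner_comm]
  unfold leray at h1 ⊢
  rw [Submodule.inner_starProjection_left_eq_right, h1]

/-- The energy identity for the difference of two curves in `L²` with square integrable
derivatives. -/
theorem norm_sub_sq_eq {T : ℝ} (hT : 0 < T) {u v u' v' : ℝ → L2 Vec}
    (hu : ContinuousOn u (Icc 0 T)) (hv : ContinuousOn v (Icc 0 T))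
    (hu' : MemLp u' 2 (volume.restrict (Ioo 0 T))) (hv' : MemLp v' 2 (volume.restrict (Ioo 0 T)))
    (hdu : IsTimeDeriv T u u') (hdv : IsTimeDeriv T v v') :
    IntervalIntegrable (fun s => 2 * inner ℝ (u s - v s) (u' s - v' s)) volume 0 T ∧
    ∀ t ∈ Icc 0 T, ‖u t - v t‖ ^ 2 = ‖u 0 - v 0‖ ^ 2
      + ∫ s in (0 : ℝ)..t, 2 * inner ℝ (u s - v s) (u' s - v' s) := by
  have iu : IntegrableOn u' (Ioo 0 T) := hu'.integrable (by norm_num)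
  have iv : IntegrableOn v' (Ioo 0 T) := hv'.integrable (by norm_num)
  have Iu : IntervalIntegrable u' volume 0 T :=
    (intervalIntegrable_iff_integrableOn_Ioo_of_le hT.le).2 iu
  have Iv : IntervalIntegrable v' volume 0 T :=
    (intervalIntegrable_iff_integrableOn_Ioo_of_le hT.le).2 iv
  have eu := hdu.eq_add_integral hT hu iu
  have ev := hdv.eq_add_integral hT hv iv
  constructor
  · rw [intervalIntegrable_iff_integrableOn_Ioo_of_le hT.le]
    obtain ⟨C, hC⟩ := isCompact_Icc.exists_bound_of_continuousOn (hu.sub hv)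
    have hm : AEStronglyMeasurable (fun s => u s - v s) (volume.restrict (Ioo 0 T)) :=
      ((hu.sub hv).mono Ioo_subset_Icc_self).aestronglyMeasurable measurableSet_Ioo
    refine Integrable.const_mul (Integrable.mono' ((iu.sub iv).norm.const_mul C)
      (hm.inner (iu.sub iv).1) ?_) 2
    filter_upwards [ae_restrict_mem measurableSet_Ioo] with s hs
    exact (norm_inner_le_norm _ _).trans
      (mul_le_mul_of_nonneg_right (hC s (Ioo_subset_Icc_self hs)) (norm_nonneg _))
  · intro t ht
    have h := bilin_self_eq_add_integral hT (f := fun t => u t - v t)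
      (F := fun t => u' t - v' t) (Iu.sub Iv) (fun t ht => by
        have hsub : uIcc 0 t ⊆ uIcc 0 T := by
          rw [uIcc_of_le ht.1, uIcc_of_le hT.le]; exact Icc_subset_Icc_right ht.2
        rw [intervalIntegral.integral_sub (Iu.mono_set hsub) (Iv.mono_set hsub), eu t ht, ev t ht]
        abel) (innerSL ℝ)
      (fun x y => (real_inner_comm y x : (inner ℝ x y : ℝ) = inner ℝ y x)) t ht
    rw [← real_inner_self_eq_norm_sq, ← real_inner_self_eq_norm_sq]
    exact h

/-- The Lions–Magenes energy identity for the difference of two curves. -/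
theorem norm_sub_sq_eq_dual {W H : Type} [NormedAddCommGroup W] [InnerProductSpace ℝ W]
    [CompleteSpace W] [NormedAddCommGroup H] [InnerProductSpace ℝ H] [CompleteSpace H]
    {ι : W →L[ℝ] H} (hι : Function.Injective ι) {T : ℝ} (hT : 0 < T) {f h : ℝ → H}
    (hf : ContinuousOn f (Icc 0 T)) (hh : ContinuousOn h (Icc 0 T)) {U V : ℝ → W}
    (hU : MemLp U 2 (volume.restrict (Ioo 0 T))) (hV : MemLp V 2 (volume.restrict (Ioo 0 T)))
    (hUf : ∀ᵐ t ∂volume.restrict (Ioo 0 T), ι (U t) = f t)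
    (hVh : ∀ᵐ t ∂volume.restrict (Ioo 0 T), ι (V t) = h t) {f' h' : ℝ → W →L[ℝ] ℝ}
    (hf' : MemLp f' 2 (volume.restrict (Ioo 0 T))) (hh' : MemLp h' 2 (volume.restrict (Ioo 0 T)))
    (hdf : IsTimeDeriv T (fun t => (innerSL ℝ (f t)).comp ι) f')
    (hdh : IsTimeDeriv T (fun t => (innerSL ℝ (h t)).comp ι) h') :
    IntervalIntegrable (fun s => 2 * (f' s - h' s) (U s - V s)) volume 0 T ∧
    ∀ t ∈ Icc 0 T, ‖f t - h t‖ ^ 2 = ‖f 0 - h 0‖ ^ 2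
      + ∫ s in (0 : ℝ)..t, 2 * (f' s - h' s) (U s - V s) := by
  have hcont : Continuous fun x : H => (innerSL ℝ x).comp ι :=
    (innerSL ℝ).continuous.clm_comp continuous_const
  have jf : IntegrableOn f' (Ioo 0 T) := hf'.integrable (by norm_num)
  have jh : IntegrableOn h' (Ioo 0 T) := hh'.integrable (by norm_num)
  have If : IntervalIntegrable f' volume 0 T :=
    (intervalIntegrable_iff_integrableOn_Ioo_of_le hT.le).2 jf
  have Ih : IntervalIntegrable h' volume 0 T :=
    (intervalIntegrable_iff_integrableOn_Ioo_of_le hT.le).2 jh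
  have ef : ∀ t ∈ Icc 0 T, (innerSL ℝ (f t)).comp ι = (innerSL ℝ (f 0)).comp ι
      + ∫ s in (0 : ℝ)..t, f' s := hdf.eq_add_integral hT (hcont.comp_continuousOn hf) jf
  have eh : ∀ t ∈ Icc 0 T, (innerSL ℝ (h t)).comp ι = (innerSL ℝ (h 0)).comp ι
      + ∫ s in (0 : ℝ)..t, h' s := hdh.eq_add_integral hT (hcont.comp_continuousOn hh) jh
  obtain ⟨i, e⟩ := norm_sq_eq_add_integral_dual hι hT
    (f := fun t => f t - h t) (hf.sub hh) (U := fun t => U t - V t) (hU.sub hV)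
    (by filter_upwards [hUf, hVh] with t h1 h2; rw [map_sub, h1, h2])
    (F := fun t => f' t - h' t) (hf'.sub hh') (fun t ht => by
      have hsub : uIcc 0 t ⊆ uIcc 0 T := by
        rw [uIcc_of_le ht.1, uIcc_of_le hT.le]; exact Icc_subset_Icc_right ht.2
      rw [intervalIntegral.integral_sub (If.mono_set hsub) (Ih.mono_set hsub), map_sub, map_sub,
        ContinuousLinearMap.sub_comp, ContinuousLinearMap.sub_comp, ef t ht, eh t ht]
      abel)
  exact ⟨(intervalIntegrable_iff_integrableOn_Ioo_of_le hT.le).2 (Integrable.const_mul i 2), e⟩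

/-! ### Integrability of the growth rate, stability and uniqueness -/

/-- The bound of the gradients of `(u, b, θ)` by the norms in `H³`. -/
def gradBound (U B : Sob 3 Vec) (Θ : Sob 3 ℝ) : ℝ := 3 * sobConst * (‖U‖ + ‖B‖ + ‖Θ‖)

theorem rate_nonneg {μ g α : ℝ} (hμ : 0 < μ) (hg : 0 < g) {L : ℝ≥0} {M S : ℝ} (hS : 0 ≤ S) :
    0 ≤ rate μ g α L M S := by
  unfold rate; positivity

theorem gradBound_nonneg (U B : Sob 3 Vec) (Θ : Sob 3 ℝ) : 0 ≤ gradBound U B Θ := by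
  have := sobConst_nonneg
  unfold gradBound; positivity

/-- The rate is a quadratic polynomial in the gradient bound, which is square integrable by the
`L²(0,T; H³)` regularity. -/
theorem integrable_rate (μ g α : ℝ) (L : ℝ≥0) (M : ℝ) {T : ℝ} {U B : ℝ → Sob 3 Vec}
    {Θ : ℝ → Sob 3 ℝ} (hU : MemLp U 2 (volume.restrict (Ioo 0 T)))
    (hB : MemLp B 2 (volume.restrict (Ioo 0 T))) (hΘ : MemLp Θ 2 (volume.restrict (Ioo 0 T))) :
    IntegrableOn (fun t => rate μ g α L M (gradBound (U t) (B t) (Θ t))) (Ioo 0 T) := by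
  have hS : MemLp (fun t => gradBound (U t) (B t) (Θ t)) 2 (volume.restrict (Ioo 0 T)) :=
    ((hU.norm.add hB.norm).add hΘ.norm).const_mul (3 * sobConst)
  have hQ : MemLp (fun t => |α * μ| * (2 * L * gradBound (U t) (B t) (Θ t) + M)) 2
      (volume.restrict (Ioo 0 T)) := ((hS.const_mul (2 * L)).add (memLp_const M)).const_mul _
  exact (((hS.integrable (by norm_num)).const_mul 18).add (integrable_const g)).add
    (hQ.integrable_sq.div_const _)

/-- Stability in `L²`: the growth of the difference of two strong solutions is controlled by the
first one. -/
theorem stability {ν μ κ g α : ℝ} (hν : 0 < ν) (hμ : 0 < μ) (hκ : 0 < κ) (hg : 0 < g)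
    {ζ : ℝ → ℝ} {L : ℝ≥0} (hL : LipschitzWith L ζ) {M : ℝ} (hM : ∀ r, |ζ r| ≤ M)
    {T : ℝ} (hT : 0 < T) {u₀ b₀ v₀ c₀ : L2 Vec} {θ₀ η₀ : L2 ℝ} {u b v c : ℝ → L2 Vec}
    {θ η : ℝ → L2 ℝ} (h : IsStrong ν μ κ g α ζ T u₀ b₀ θ₀ u b θ)
    (k : IsStrong ν μ κ g α ζ T v₀ c₀ η₀ v c η) {U B : ℝ → Sob 3 Vec} {Θ : ℝ → Sob 3 ℝ}
    (hU : MemLp U 2 (volume.restrict (Ioo 0 T)))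
    (hB : MemLp B 2 (volume.restrict (Ioo 0 T))) (hΘ : MemLp Θ 2 (volume.restrict (Ioo 0 T)))
    (hUu : ∀ᵐ t ∂volume.restrict (Ioo 0 T), toL2 3 Vec (U t) = u t)
    (hBb : ∀ᵐ t ∂volume.restrict (Ioo 0 T), toL2 3 Vec (B t) = b t)
    (hΘθ : ∀ᵐ t ∂volume.restrict (Ioo 0 T), toL2 3 ℝ (Θ t) = θ t) :
    ∀ t ∈ Icc 0 T, ‖u t - v t‖ ^ 2 + ‖b t - c t‖ ^ 2 + ‖θ t - η t‖ ^ 2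
      ≤ Real.exp (∫ s in (0 : ℝ)..T, 2 * rate μ g α L M (gradBound (U s) (B s) (Θ s))) *
        (‖u₀ - v₀‖ ^ 2 + ‖b₀ - c₀‖ ^ 2 + ‖θ₀ - η₀‖ ^ 2) := by
  obtain ⟨u', hu', hdu, hequ⟩ := h.u_eq
  obtain ⟨b', hb', hdb, heqb⟩ := h.b_eq
  obtain ⟨θ', hθ', hdθ, heqθ⟩ := h.θ_eq
  obtain ⟨v', hv', hdv, heqv⟩ := k.u_eq
  obtain ⟨c', hc', hdc, heqc⟩ := k.b_eq
  obtain ⟨η', hη', hdη, heqη⟩ := k.θ_eq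
  obtain ⟨V, hV, hVv⟩ := k.u_int3
  obtain ⟨C, hC, hCc⟩ := k.b_int3
  obtain ⟨H, hH, hHη⟩ := k.θ_int3
  -- The duality with `H⁻¹` requires `H¹` representatives of the temperatures, besides the `H³` ones
  -- used for sup bounds; they have the same image in `L²` for almost every time.
  obtain ⟨Θ₁, hΘ₁, hΘ₁θ⟩ := h.θ_int
  obtain ⟨H₁, hH₁, hH₁η⟩ := k.θ_int
  obtain ⟨iw, ew⟩ := norm_sub_sq_eq hT h.u_cont.continuousOn k.u_cont.continuousOn hu' hv' hdu hdv
  obtain ⟨jd, ed⟩ := norm_sub_sq_eq hT h.b_cont.continuousOn k.b_cont.continuousOn hb' hc' hdb hdc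
  obtain ⟨iφ2, eφ⟩ := norm_sub_sq_eq_dual toL2_one_injective hT h.θ_cont k.θ_cont hΘ₁ hH₁ hΘ₁θ hH₁η
    hθ' hη' hdθ hdη
  have main := gronwall_integral hT.le
    (y := fun t => ‖u t - v t‖ ^ 2 + ‖b t - c t‖ ^ 2 + ‖θ t - η t‖ ^ 2)
    (G := fun s => 2 * inner ℝ (u s - v s) (u' s - v' s) + 2 * inner ℝ (b s - c s) (b' s - c' s)
      + 2 * (θ' s - η' s) (Θ₁ s - H₁ s))
    (A := fun s => 2 * rate μ g α L M (gradBound (U s) (B s) (Θ s)))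
    ((iw.add jd).add iφ2)
    ((intervalIntegrable_iff_integrableOn_Ioo_of_le hT.le).2
      (Integrable.const_mul (integrable_rate μ g α L M hU hB hΘ) 2))
    (Eventually.of_forall fun t =>
      mul_nonneg zero_le_two (rate_nonneg hμ hg (gradBound_nonneg _ _ _)))
    (fun t ht => by
      have hsub : uIcc 0 t ⊆ uIcc 0 T := by
        rw [uIcc_of_le ht.1, uIcc_of_le hT.le]; exact Icc_subset_Icc_right ht.2
      rw [intervalIntegral.integral_add ((iw.mono_set hsub).add (jd.mono_set hsub))
        (iφ2.mono_set hsub), intervalIntegral.integral_add (iw.mono_set hsub) (jd.mono_set hsub),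
        ew t ht, ed t ht, eφ t ht]
      ring)
    (by positivity) ?_
  · rw [h.u_init, h.b_init, h.θ_init, k.u_init, k.b_init, k.θ_init] at main
    exact main
  filter_upwards [hequ, heqb, heqθ, heqv, heqc, heqη, hUu, hBb, hΘθ, hVv, hCc, hHη, hΘ₁θ, hH₁η,
    ae_restrict_mem measurableSet_Ioo] with t h1 h2 h3 k1 k2 k3 l1 l2 l3 m1 m2 m3 n1 n2 ht
  have htI := Ioo_subset_Icc_self ht
  obtain ⟨-, R₁, hR₁, hu'⟩ := h1
  obtain ⟨-, R₂, hR₂, hb'⟩ := h2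
  obtain ⟨-, R₁', hR₁', hv'⟩ := k1
  obtain ⟨-, R₂', hR₂', hc'⟩ := k2
  have gu : RegularField (u t) := l1 ▸ regularField (by norm_num) (U t) (l1 ▸ h.u_mem t htI)
  have gb : RegularField (b t) := l2 ▸ regularField (by norm_num) (B t) (l2 ▸ h.b_mem t htI)
  have gv : RegularField (v t) := m1 ▸ regularField (by norm_num) (V t) (m1 ▸ k.u_mem t htI)
  have gc : RegularField (c t) := m2 ▸ regularField (by norm_num) (C t) (m2 ▸ k.b_mem t htI)
  have gθ : RegularScalar (θ t) := l3 ▸ regularScalar (by norm_num) (Θ t)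
  have gη : RegularScalar (η t) := m3 ▸ regularScalar (by norm_num) (H t)
  have hφ3 : toL2 3 ℝ (Θ t - H t) = θ t - η t := by rw [map_sub, l3, m3]
  have hφ1 : toL2 1 ℝ (Θ₁ t - H₁ t) = θ t - η t := by rw [map_sub, n1, n2]
  have gφ : RegularScalar (toL2 1 ℝ (Θ₁ t - H₁ t)) := by
    rw [hφ1, ← hφ3]; exact regularScalar (by norm_num) _
  have sc := sobConst_nonneg
  have hle : ∀ n : ℝ, n ≤ ‖U t‖ + ‖B t‖ + ‖Θ t‖ →
      3 * sobConst * n ≤ gradBound (U t) (B t) (Θ t) := fun n hn =>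
    mul_le_mul_of_nonneg_left hn (by positivity)
  have key := energy_inequality (α := α) hν hμ hκ hg hL hM gu gb gv gc gθ gη gφ hφ1
    (S := gradBound (U t) (B t) (Θ t))
    (fun i j => by
      rw [← l1]
      exact (Sob.ae_abs_wd_le le_rfl (U t) (EuclideanSpace.proj i) (abs_proj_le i) j).mono
        fun x hx => hx.trans (hle _ (by linarith [norm_nonneg (B t), norm_nonneg (Θ t)])))
    (fun i j => by
      rw [← l2]
      exact (Sob.ae_abs_wd_le le_rfl (B t) (EuclideanSpace.proj i) (abs_proj_le i) j).mono
        fun x hx => hx.trans (hle _ (by linarith [norm_nonneg (U t), norm_nonneg (Θ t)])))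
    (fun j => by
      rw [← l3]
      exact (Sob.ae_abs_wd_le le_rfl (Θ t) (ContinuousLinearMap.id ℝ ℝ) (fun _ => le_rfl) j).mono
        fun x hx => hx.trans (hle _ (by linarith [norm_nonneg (U t), norm_nonneg (B t)])))
    hR₁ hR₁' hR₂ hR₂'
  -- The heat integrals are the right-hand sides of the weak equation tested with `Θ₁ t - H₁ t`, so
  -- they become the pairings with `θ'` and `η'`.
  rw [(integral_heatDensity μ κ α hL.continuous hM gu gb gθ gφ).2,
    (integral_heatDensity μ κ α hL.continuous hM gv gc gη gφ).2, ← h3 (Θ₁ t - H₁ t),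
    ← k3 (Θ₁ t - H₁ t), hφ1] at key
  rw [hu', hv', hb', hc',
    inner_leray_sub (spaceV_le_spaceH (sub_mem (h.u_mem t htI) (k.u_mem t htI))),
    inner_leray_sub (spaceV_le_spaceH (sub_mem (h.b_mem t htI) (k.b_mem t htI))),
    sub_apply]
  linarith

theorem eq_of_sum_norm_sq_le {u v b c : L2 Vec} {θ η : L2 ℝ}
    (h : ‖u - v‖ ^ 2 + ‖b - c‖ ^ 2 + ‖θ - η‖ ^ 2 ≤ 0) : u = v ∧ b = c ∧ θ = η := by
  have z : ∀ r : ℝ, r ^ 2 ≤ 0 → r = 0 := fun r hr => pow_eq_zero_iff two_ne_zero |>.1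
    (le_antisymm hr (sq_nonneg r))
  refine ⟨sub_eq_zero.1 (norm_eq_zero.1 (z _ ?_)), sub_eq_zero.1 (norm_eq_zero.1 (z _ ?_)),
    sub_eq_zero.1 (norm_eq_zero.1 (z _ ?_))⟩ <;>
  nlinarith [sq_nonneg ‖u - v‖, sq_nonneg ‖b - c‖, sq_nonneg ‖θ - η‖]

/-- Strong solutions are unique. -/
theorem IsStrong.unique {ν μ κ g α : ℝ} (hν : 0 < ν) (hμ : 0 < μ) (hκ : 0 < κ) (hg : 0 < g)
    {ζ : ℝ → ℝ} {L : ℝ≥0} (hL : LipschitzWith L ζ) {M : ℝ} (hM : ∀ r, |ζ r| ≤ M)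
    {T : ℝ} (hT : 0 < T) {u₀ b₀ : L2 Vec} {θ₀ : L2 ℝ} {u b v c : ℝ → L2 Vec}
    {θ η : ℝ → L2 ℝ} (h : IsStrong ν μ κ g α ζ T u₀ b₀ θ₀ u b θ)
    (k : IsStrong ν μ κ g α ζ T u₀ b₀ θ₀ v c η) :
    ∀ t ∈ Icc 0 T, u t = v t ∧ b t = c t ∧ θ t = η t := by
  intro t ht
  obtain ⟨U, hU, hUu⟩ := h.u_int3
  obtain ⟨B, hB, hBb⟩ := h.b_int3
  obtain ⟨Θ, hΘ, hΘθ⟩ := h.θ_int3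
  have := stability hν hμ hκ hg hL hM hT h k hU hB hΘ hUu hBb hΘθ t ht
  exact eq_of_sum_norm_sq_le (by simpa using this)

end

end CalmedMHD

end

/-! ### Main theorem -/

theorem mainTheorem3
    (ν μ κ g α : ℝ) (hν : 0 < ν) (hμ : 0 < μ) (hκ : 0 < κ) (hg : 0 < g)
    (ζ : ℝ → ℝ) (L : ℝ≥0) (hL : LipschitzWith L ζ) (M : ℝ) (hM : ∀ r, |ζ r| ≤ M)
    (T : ℝ) (hT : 0 < T)
    (u₀ b₀ : CalmedMHD.L2 CalmedMHD.Vec) (θ₀ : CalmedMHD.L2 ℝ)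
    (hu₀ : u₀ ∈ CalmedMHD.sobSet 2 CalmedMHD.Vec ⊓ CalmedMHD.spaceV)
    (hb₀ : b₀ ∈ CalmedMHD.sobSet 2 CalmedMHD.Vec ⊓ CalmedMHD.spaceV) :
    (∀ (u b : ℝ → CalmedMHD.L2 CalmedMHD.Vec) (θ : ℝ → CalmedMHD.L2 ℝ)
       (v c : ℝ → CalmedMHD.L2 CalmedMHD.Vec) (η : ℝ → CalmedMHD.L2 ℝ),
       CalmedMHD.IsStrong ν μ κ g α ζ T u₀ b₀ θ₀ u b θ →
       CalmedMHD.IsStrong ν μ κ g α ζ T u₀ b₀ θ₀ v c η →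
       ∀ t ∈ Icc 0 T, u t = v t ∧ b t = c t ∧ θ t = η t) ∧
    (∃ K : ℝ, 0 < K ∧
       ∀ (u b : ℝ → CalmedMHD.L2 CalmedMHD.Vec) (θ : ℝ → CalmedMHD.L2 ℝ),
       CalmedMHD.IsStrong ν μ κ g α ζ T u₀ b₀ θ₀ u b θ →
       ∀ v₀ ∈ CalmedMHD.sobSet 2 CalmedMHD.Vec ⊓ CalmedMHD.spaceV,
       ∀ c₀ ∈ CalmedMHD.sobSet 2 CalmedMHD.Vec ⊓ CalmedMHD.spaceV,
       ∀ (η₀ : CalmedMHD.L2 ℝ)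
         (v c : ℝ → CalmedMHD.L2 CalmedMHD.Vec) (η : ℝ → CalmedMHD.L2 ℝ),
       CalmedMHD.IsStrong ν μ κ g α ζ T v₀ c₀ η₀ v c η →
       ∀ t ∈ Icc 0 T,
         ‖u t - v t‖ ^ 2 + ‖b t - c t‖ ^ 2 + ‖θ t - η t‖ ^ 2
           ≤ K * (‖u₀ - v₀‖ ^ 2 + ‖b₀ - c₀‖ ^ 2 + ‖θ₀ - η₀‖ ^ 2)) := by
  refine ⟨fun u b θ v c η h k => h.unique hν hμ hκ hg hL hM hT k, ?_⟩
  -- `K` must be fixed before the solution is given: take it from one solution with these data if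
  -- there is any, and any positive number otherwise.
  by_cases hex : ∃ (u b : ℝ → CalmedMHD.L2 CalmedMHD.Vec) (θ : ℝ → CalmedMHD.L2 ℝ),
      CalmedMHD.IsStrong ν μ κ g α ζ T u₀ b₀ θ₀ u b θ
  · obtain ⟨u, b, θ, h⟩ := hex
    obtain ⟨U, hU, hUu⟩ := h.u_int3
    obtain ⟨B, hB, hBb⟩ := h.b_int3
    obtain ⟨Θ, hΘ, hΘθ⟩ := h.θ_int3
    refine ⟨Real.exp (∫ s in (0 : ℝ)..T,
      2 * CalmedMHD.rate μ g α L M (CalmedMHD.gradBound (U s) (B s) (Θ s))), Real.exp_pos _, fun u₁ b₁ θ₁ h₁ v₀ _ c₀ _ η₀ v c η k t ht => ?_⟩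
    -- By uniqueness the given solution coincides with the one that defines `K`.
    obtain ⟨e1, e2, e3⟩ := h₁.unique hν hμ hκ hg hL hM hT h t ht
    rw [e1, e2, e3]
    exact CalmedMHD.stability hν hμ hκ hg hL hM hT h k hU hB hΘ hUu hBb hΘθ t ht
  · exact ⟨1, one_pos, fun u b θ h => absurd ⟨u, b, θ, h⟩ hex⟩
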